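/- Let $n \ge 2$ and let $\alpha \in \mathbb{R}$, $\alpha \neq 0$. A rectangular box in $\mathbb{R}^n$ is a Cartesian product $\mathcal{B} = \prod_{j=1}^n (a_j,b_j)$ of $n$ bounded open intervals with $a_j<b_j$, and a cube is a box all of whose edge lengths $b_j-a_j$ are equal. Let $\lambda_1(\mathcal{B};\alpha) < \lambda_2(\mathcal{B};\alpha) \le \lambda_3(\mathcal{B};\alpha) \le \cdots$ denote the eigenvalues, counted with multiplicity, of the Robin Laplacian \[ -\Delta u = \lambda u \ \text{ in } \mathcal{B}, \qquad \frac{\partial u}{\partial \nu} + \alpha u = 0 \ \text{ on } \partial\mathcal{B}, \] understood in the weak sense: $u \in H^1(\mathcal{B})$, $u \ne 0$, and $\int_{\mathcal{B}} \nabla u \cdot \nabla v \, dx + \alpha \int_{\partial \mathcal{B}} u v \, dS = \lambda \int_{\mathcal{B}} u v \, dx$ for all $v \in H^1(\mathcal{B})$. Then $\lambda_1(\mathcal{B};\alpha) \ne 0$ for every rectangular box $\mathcal{B}$, so that the spectral ratio $\lambda_2(\mathcal{B};\alpha)/|\lambda_1(\mathcal{B};\alpha)|$ is well defined, and among rectangular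 boxes of given volume this ratio is maximal for the cube and only for the cube: if $\mathcal{B}$ is a rectangular box and $\mathcal{Q}$ is a cube with the same volume, then \[ \frac{\lambda_2(\mathcal{B};\alpha)}{|\lambda_1(\mathcal{B};\alpha)|} \le \frac{\lambda_2(\mathcal{Q};\alpha)}{|\lambda_1(\mathcal{Q};\alpha)|}, \] with equality if and only if $\mathcal{B}$ is a cube. -/

import Mathlib

open MeasureTheory Filter Topology
open scoped ContDiff

noncomputable section

/-- The rectangular box `(a 0, b 0) × ⋯ × (a (n-1), b (n-1))` in `ℝⁿ`. -/
def openBox {n : ℕ} (a b : Fin n → ℝ) : Set (Fin n → ℝ) :=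
  Set.univ.pi fun j => Set.Ioo (a j) (b j)

/-- A box is a cube if all its edges have the same length. -/
def IsCube {n : ℕ} (a b : Fin n → ℝ) : Prop :=
  ∀ i j, b i - a i = b j - a j

/-- Surface measure on the face of the box that lies in the hyperplane `x i = c`: the product of
the Dirac mass at `c` in the `i`-th coordinate and of Lebesgue measure on the edges of the box in
all the other coordinates. -/
def faceMeasure {n : ℕ} (a b : Fin n → ℝ) (i : Fin n) (c : ℝ) : Measure (Fin n → ℝ) :=
  Measure.pi (Function.update (fun j => (volume : Measure ℝ).restrict (Set.Ioo (a j) (b j))) i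
    (Measure.dirac c))

/-- Surface measure `dS` on the boundary of the box: the sum over its `2n` faces. (The edges where
faces meet have measure zero.) -/
def surfaceMeasure {n : ℕ} (a b : Fin n → ℝ) : Measure (Fin n → ℝ) :=
  ∑ i, (faceMeasure a b i (a i) + faceMeasure a b i (b i))

/-- The real Hilbert space `L²(B)` of the box `B`. -/
abbrev L2Box {n : ℕ} (a b : Fin n → ℝ) : Type :=
  Lp ℝ 2 ((volume : Measure (Fin n → ℝ)).restrict (openBox a b))

/-- The real Hilbert space `L²(∂B)` with respect to surface measure. -/
abbrev L2Boundary {n : ℕ} (a b : Fin n → ℝ) : Type :=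
  Lp ℝ 2 (surfaceMeasure a b)

/-- The classical partial derivative `∂φ/∂xᵢ`. -/
def partialDeriv {n : ℕ} (i : Fin n) (φ : (Fin n → ℝ) → ℝ) (x : Fin n → ℝ) : ℝ :=
  fderiv ℝ φ x (Pi.single i 1)

/-- `G = (G 0, …, G (n-1))`, with components in `L²(B)`, is the weak gradient of `u ∈ L²(B)`.
Thus `u ∈ H¹(B)` if and only if `u` has such a `G` (which is then unique). -/
def IsWeakGradient {n : ℕ} {a b : Fin n → ℝ} (u : L2Box a b) (G : Fin n → L2Box a b) : Prop :=
  ∀ i, ∀ φ : (Fin n → ℝ) → ℝ, ContDiff ℝ ∞ φ → HasCompactSupport φ → tsupport φ ⊆ openBox a b →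
    ∫ x in openBox a b, u x * partialDeriv i φ x = -∫ x in openBox a b, G i x * φ x

/-- `τ ∈ L²(∂B)` is the boundary trace of `u ∈ H¹(B)`, where `G` is the weak gradient of `u`:
some functions `φ k` that are smooth up to the boundary converge to `u` in `H¹(B)`, and their
restrictions to the boundary converge to `τ` in `L²(∂B)`. Every `u ∈ H¹(B)` has exactly one
trace. -/
def IsTrace {n : ℕ} {a b : Fin n → ℝ} (u : L2Box a b) (G : Fin n → L2Box a b)
    (τ : L2Boundary a b) : Prop :=
  ∃ φ : ℕ → (Fin n → ℝ) → ℝ, (∀ k, ContDiff ℝ ∞ (φ k)) ∧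
    Tendsto (fun k => eLpNorm (fun x => φ k x - u x) 2 (volume.restrict (openBox a b)))
      atTop (𝓝 0) ∧
    (∀ i, Tendsto (fun k => eLpNorm (fun x => partialDeriv i (φ k) x - G i x) 2
      (volume.restrict (openBox a b))) atTop (𝓝 0)) ∧
    Tendsto (fun k => eLpNorm (fun x => φ k x - τ x) 2 (surfaceMeasure a b)) atTop (𝓝 0)

/-- `u` solves the Robin eigenvalue problem `-Δu = μ u` in `B`, `∂u/∂ν + α u = 0` on `∂B`, in the
weak sense: `u ∈ H¹(B)` and
`∫_B ∇u · ∇v dx + α ∫_{∂B} u v dS = μ ∫_B u v dx` for all `v ∈ H¹(B)`.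
(`G`, `H` are the weak gradients and `τ`, `η` the traces of `u`, `v`; the inner products are those
of `L²(B)` and `L²(∂B)`.) The trivial solution `u = 0` is included. -/
def IsRobinSolution {n : ℕ} {a b : Fin n → ℝ} (α μ : ℝ) (u : L2Box a b) : Prop :=
  ∃ G τ, IsWeakGradient u G ∧ IsTrace u G τ ∧
    ∀ v H η, IsWeakGradient v H → IsTrace v H η →
      (∑ i, inner ℝ (G i) (H i)) + α * inner ℝ τ η = μ * inner ℝ u v

/-- The span in `L²(B)` of all Robin eigenfunctions with eigenvalue at most `Λ`. Its dimension is
the number of eigenvalues in `(-∞, Λ]`, counted with multiplicity. -/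
def robinSpan {n : ℕ} (a b : Fin n → ℝ) (α Λ : ℝ) : Submodule ℝ (L2Box a b) :=
  Submodule.span ℝ {u | ∃ μ ≤ Λ, IsRobinSolution α μ u}

/-- The `k`-th eigenvalue `λₖ(B; α)` of the Robin Laplacian (`k = 1, 2, …`), counted with
multiplicity in increasing order: the least `Λ` such that at least `k` eigenvalues, with
multiplicity, are at most `Λ`. -/
def robinEigenvalue {n : ℕ} (a b : Fin n → ℝ) (α : ℝ) (k : ℕ) : ℝ :=
  sInf {Λ : ℝ | (k : Cardinal) ≤ Module.rank ℝ (robinSpan a b α Λ)}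

/-- The spectral ratio `λ₂(B; α) / |λ₁(B; α)|`. -/
def spectralRatio {n : ℕ} (a b : Fin n → ℝ) (α : ℝ) : ℝ :=
  robinEigenvalue a b α 2 / |robinEigenvalue a b α 1|

end

/-- `u` is a classical solution of the Robin problem `-u'' = μ u` on the interval `(a, b)`. -/
structure RobinMode (α a b μ : ℝ) (u : ℝ → ℝ) : Prop where
  smooth : ContDiff ℝ ∞ u
  eqn : ∀ x, HasDerivAt (deriv u) (-μ * u x) x
  left : deriv u a = α * u a
  right : deriv u b = -α * u b

/-- A pair of one-dimensional Robin modes, the first nonzero at a point `m` and the second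
vanishing, to first order, at `m` only. These are the first two modes of the interval. -/
structure RobinPair (α a b μ ν m : ℝ) (u w : ℝ → ℝ) : Prop where
  fst : RobinMode α a b μ u
  snd : RobinMode α a b ν w
  lt_mid : a < m
  mid_lt : m < b
  fst_mid : u m ≠ 0
  snd_mid : w m = 0
  deriv_snd_mid : deriv w m ≠ 0
  snd_ne : ∀ x ∈ Set.Icc a b, x ≠ m → w x ≠ 0
  lt : μ < ν

namespace RobinMode

variable {α a b μ : ℝ} {u : ℝ → ℝ}

lemma hasDerivAt (h : RobinMode α a b μ u) (x : ℝ) : HasDerivAt u (deriv u x) x :=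
  (h.smooth.differentiable (by simp) x).hasDerivAt

lemma continuous (h : RobinMode α a b μ u) : Continuous u := h.smooth.continuous

lemma continuous_deriv (h : RobinMode α a b μ u) : Continuous (deriv u) :=
  h.smooth.continuous_deriv (by simp)

/-- The weak form of the Robin problem on an interval, tested against a `C¹` function. -/
lemma weak_form (h : RobinMode α a b μ u) {v : ℝ → ℝ} (hv : ContDiff ℝ 1 v) :
    (∫ x in a..b, deriv u x * deriv v x) + α * (u a * v a + u b * v b)
      = μ * ∫ x in a..b, u x * v x := by
  have hv' : ∀ x, HasDerivAt v (deriv v x) x := fun x =>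
    (hv.differentiable (by simp) x).hasDerivAt
  have hcv : Continuous (deriv v) := hv.continuous_deriv (by simp)
  have key := intervalIntegral.integral_mul_deriv_eq_deriv_mul (a := a) (b := b)
    (fun x _ => h.eqn x) (fun x _ => hv' x)
    ((continuous_const.mul h.continuous).intervalIntegrable _ _) (hcv.intervalIntegrable _ _)
  rw [key, h.left, h.right]
  have : (∫ x in a..b, -μ * u x * v x) = -μ * ∫ x in a..b, u x * v x := by
    rw [← intervalIntegral.integral_const_mul]
    congr 1; ext x; ring
  rw [this]; ring

end RobinMode

namespace RobinPair

variable {α a b μ ν m : ℝ} {u w : ℝ → ℝ}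

lemma continuousAt_sq_div {h : ℝ → ℝ} (hp : RobinPair α a b μ ν m u w)
    (hh : DifferentiableAt ℝ h m) (h0 : h m = 0) :
    ContinuousAt (fun x => deriv w x * h x ^ 2 / w x) m := by
  have hw := (hp.snd.hasDerivAt m)
  rw [continuousAt_iff_punctured_nhds]
  have e1 := hasDerivAt_iff_tendsto_slope.1 hw
  have e2 := hasDerivAt_iff_tendsto_slope.1 hh.hasDerivAt
  have e3 : Tendsto h (𝓝[≠] m) (𝓝 (h m)) := hh.continuousAt.tendsto.mono_left nhdsWithin_le_nhds
  have e4 : Tendsto (deriv w) (𝓝[≠] m) (𝓝 (deriv w m)) :=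
    hp.snd.continuous_deriv.continuousAt.tendsto.mono_left nhdsWithin_le_nhds
  have := (e4.mul (e3.mul (e2.div e1 hp.deriv_snd_mid)))
  simp only [h0, zero_mul, mul_zero] at this
  simp only [h0, hp.snd_mid, div_zero]
  refine this.congr' ?_
  filter_upwards [self_mem_nhdsWithin] with x hx
  have hx' : x - m ≠ 0 := sub_ne_zero.2 hx
  simp only [Pi.div_apply, slope_def_field, h0, hp.snd_mid, sub_zero]
  by_cases hwx : w x = 0
  · simp [hwx]
  · field_simp

/-- The Rayleigh quotient bound on the hyperplane `h m = 0`. -/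
lemma le_energy_of_vanish (hp : RobinPair α a b μ ν m u w) {h : ℝ → ℝ} (hh : ContDiff ℝ 1 h)
    (h0 : h m = 0) :
    ν * (∫ x in a..b, h x ^ 2) ≤ (∫ x in a..b, deriv h x ^ 2) + α * (h a ^ 2 + h b ^ 2) := by
  have hd : ∀ x, HasDerivAt h (deriv h x) x := fun x =>
    (hh.differentiable (by simp) x).hasDerivAt
  have hch : Continuous (deriv h) := hh.continuous_deriv (by simp)
  set F : ℝ → ℝ := fun x => deriv w x * h x ^ 2 / w x with hF
  set φ : ℝ → ℝ := fun x => deriv h x ^ 2 - ν * h x ^ 2 with hφ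
  have hφc : Continuous φ := by
    have := hh.continuous
    fun_prop
  have hcont : ContinuousOn F (Set.Icc a b) := by
    intro x hx
    by_cases hxm : x = m
    · subst hxm
      exact (hp.continuousAt_sq_div (hd x).differentiableAt h0).continuousWithinAt
    · have := hp.snd.continuous.continuousAt (x := x)
      have := hp.snd.continuous_deriv.continuousAt (x := x)
      have := hh.continuous.continuousAt (x := x)
      have hw := hp.snd_ne x hx hxm
      exact ContinuousAt.continuousWithinAt (by fun_prop (disch := assumption))
  have hder : ∀ x ∈ Set.Icc a b, x ≠ m → ∃ F' ≤ φ x, HasDerivAt F F' x := by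
    intro x hx hxm
    have hw := hp.snd_ne x hx hxm
    refine ⟨_, ?_, ((hp.snd.eqn x).mul ((hd x).pow 2)).div (hp.snd.hasDerivAt x) hw⟩
    have : 0 ≤ (deriv h x - deriv w x / w x * h x) ^ 2 := sq_nonneg _
    refine sub_nonneg.1 (this.trans_eq ?_)
    simp only [hφ, Pi.pow_apply, Pi.mul_apply]
    field_simp
    push_cast
    ring
  have am := hp.lt_mid
  have mb := hp.mid_lt
  have piece : ∀ p q, p ≤ q → Set.Icc p q ⊆ Set.Icc a b → m ∉ Set.Ioo p q →
      F q - F p ≤ ∫ x in p..q, φ x := by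
    intro p q hpq hsub hm
    have hne : ∀ x ∈ Set.Ioo p q, x ≠ m := fun x hx hxm => hm (hxm ▸ hx)
    have hd' : ∀ x, ∃ F', x ∈ Set.Ioo p q → F' ≤ φ x ∧ HasDerivAt F F' x := by
      intro x
      by_cases hx : x ∈ Set.Ioo p q
      · obtain ⟨F', h1, h2⟩ := hder x (hsub (Set.Ioo_subset_Icc_self hx)) (hne x hx)
        exact ⟨F', fun _ => ⟨h1, h2⟩⟩
      · exact ⟨0, fun h => absurd h hx⟩
    choose F' hF' using hd'
    exact intervalIntegral.sub_le_integral_of_hasDeriv_right_of_le hpq (hcont.mono hsub)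
      (fun x hx => (hF' x hx).2.hasDerivWithinAt) (hφc.integrableOn_Icc) (fun x hx => (hF' x hx).1)
  have h1 := piece a m am.le (Set.Icc_subset_Icc_right mb.le) (by simp)
  have h2 := piece m b mb.le (Set.Icc_subset_Icc_left am.le) (by simp)
  have hFm : F m = 0 := by simp [hF, h0]
  have hFa : F a = α * h a ^ 2 := by
    have := hp.snd_ne a ⟨le_rfl, (am.trans mb).le⟩ am.ne
    simp only [hF, hp.snd.left]; field_simp
  have hFb : F b = -α * h b ^ 2 := by
    have := hp.snd_ne b ⟨(am.trans mb).le, le_rfl⟩ mb.ne'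
    simp only [hF, hp.snd.right]; field_simp
  have hsum := intervalIntegral.integral_add_adjacent_intervals
    (hφc.intervalIntegrable (μ := volume) a m) (hφc.intervalIntegrable m b)
  have hsplit : (∫ x in a..b, φ x)
      = (∫ x in a..b, deriv h x ^ 2) - ν * ∫ x in a..b, h x ^ 2 := by
    rw [← intervalIntegral.integral_const_mul, ← intervalIntegral.integral_sub]
    · exact (hch.pow 2).intervalIntegrable _ _
    · exact (continuous_const.mul (hh.continuous.pow 2)).intervalIntegrable _ _
  rw [hFm, hFa] at h1
  rw [hFm, hFb] at h2
  linarith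

lemma integral_sq_pos (hp : RobinPair α a b μ ν m u w) : 0 < ∫ x in a..b, u x ^ 2 :=
  intervalIntegral.integral_pos (hp.lt_mid.trans hp.mid_lt) (hp.fst.continuous.pow 2).continuousOn
    (fun _ _ => sq_nonneg _) ⟨m, ⟨hp.lt_mid.le, hp.mid_lt.le⟩, sq_pos_of_ne_zero hp.fst_mid⟩

/-- The spectral gap inequality on an interval. -/
lemma gap_le_energy (hp : RobinPair α a b μ ν m u w) {h : ℝ → ℝ} (hh : ContDiff ℝ 1 h) :
    (ν - μ) * ((∫ x in a..b, h x ^ 2)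
        - (∫ x in a..b, h x * u x) ^ 2 / ∫ x in a..b, u x ^ 2)
      ≤ (∫ x in a..b, deriv h x ^ 2) + α * (h a ^ 2 + h b ^ 2) - μ * ∫ x in a..b, h x ^ 2 := by
  have hu1 : ContDiff ℝ 1 u := hp.fst.smooth.of_le (by simp)
  have hch : Continuous (deriv h) := hh.continuous_deriv (by simp)
  have hc := hh.continuous
  have hcu := hp.fst.continuous
  have hcu' := hp.fst.continuous_deriv
  set c := h m / u m with hcdef
  have hk : ContDiff ℝ 1 (fun x => h x - c * u x) := hh.sub (contDiff_const.mul hu1)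
  have key := hp.le_energy_of_vanish hk (by simp [hcdef, hp.fst_mid])
  have hder : ∀ x, deriv (fun x => h x - c * u x) x = deriv h x - c * deriv u x := fun x =>
    (((hh.differentiable (by simp) x).hasDerivAt).sub ((hp.fst.hasDerivAt x).const_mul c)).deriv
  have expand : ∀ p q : ℝ → ℝ, Continuous p → Continuous q →
      (∫ x in a..b, (p x - c * q x) ^ 2) = (∫ x in a..b, p x ^ 2)
        - 2 * c * (∫ x in a..b, p x * q x) + c ^ 2 * ∫ x in a..b, q x ^ 2 := by
    intro p q hp hq
    have i1 : IntervalIntegrable (fun x => p x ^ 2) volume a b := (hp.pow 2).intervalIntegrable _ _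
    have i2 : IntervalIntegrable (fun x => 2 * c * (p x * q x)) volume a b :=
      (continuous_const.mul (hp.mul hq)).intervalIntegrable _ _
    have i3 : IntervalIntegrable (fun x => c ^ 2 * q x ^ 2) volume a b :=
      (continuous_const.mul (hq.pow 2)).intervalIntegrable _ _
    rw [← intervalIntegral.integral_const_mul, ← intervalIntegral.integral_const_mul,
      ← intervalIntegral.integral_sub i1 i2, ← intervalIntegral.integral_add (i1.sub i2) i3]
    congr 1; ext x; ring
  simp only [hder] at key
  rw [expand h u hc hcu, expand (deriv h) (deriv u) hch hcu'] at key
  have w1 := hp.fst.weak_form hh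
  have w2 := hp.fst.weak_form hu1
  have c1 : (∫ x in a..b, deriv h x * deriv u x) = ∫ x in a..b, deriv u x * deriv h x := by
    simp only [mul_comm]
  have c2 : (∫ x in a..b, u x * h x) = ∫ x in a..b, h x * u x := by simp only [mul_comm]
  have c3 : (∫ x in a..b, u x * u x) = ∫ x in a..b, u x ^ 2 := by simp only [sq]
  have c4 : (∫ x in a..b, deriv u x * deriv u x) = ∫ x in a..b, deriv u x ^ 2 := by simp only [sq]
  rw [c2] at w1
  rw [c3, c4] at w2
  rw [c1] at key
  have hN := hp.integral_sq_pos
  set N := ∫ x in a..b, u x ^ 2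
  set A := ∫ x in a..b, h x * u x
  set H := ∫ x in a..b, h x ^ 2
  have hsq : H - A ^ 2 / N ≤ H - 2 * c * A + c ^ 2 * N := by
    have : 0 ≤ (c * N - A) ^ 2 / N := by positivity
    have e : (c * N - A) ^ 2 / N = c ^ 2 * N - 2 * c * A + A ^ 2 / N := by field_simp; ring
    linarith
  have hgap : 0 ≤ ν - μ := sub_nonneg.2 hp.lt.le
  refine (mul_le_mul_of_nonneg_left hsq hgap).trans ?_
  linear_combination key - 2 * c * w1 + c ^ 2 * w2

end RobinPair

/-- Replacing one coordinate of a random point of a finite product measure. -/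
lemma map_update_pi_prod {n : ℕ} (μ : Fin n → Measure ℝ) [∀ i, IsFiniteMeasure (μ i)]
    (ν : Measure ℝ) [IsFiniteMeasure ν] (j : Fin n) (hj : μ j Set.univ ≠ 0) :
    Measure.map (fun p : (Fin n → ℝ) × ℝ => Function.update p.1 j p.2) ((Measure.pi μ).prod ν)
      = μ j Set.univ • Measure.pi (Function.update μ j ν) := by
  have hsf : ∀ i, SigmaFinite (Function.update μ j ν i) := by
    intro i
    by_cases h : i = j
    · subst h; rw [Function.update_self]; infer_instance
    · rw [Function.update_of_ne h]; infer_instance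
  have hfin : μ j Set.univ ≠ ⊤ := measure_ne_top _ _
  have hmeas : Measurable fun p : (Fin n → ℝ) × ℝ => Function.update p.1 j p.2 := by
    have : Continuous fun p : (Fin n → ℝ) × ℝ => Function.update p.1 j p.2 :=
      continuous_fst.update j continuous_snd
    exact this.measurable
  have key : Measure.pi (Function.update μ j ν) = (μ j Set.univ)⁻¹ •
      Measure.map (fun p : (Fin n → ℝ) × ℝ => Function.update p.1 j p.2)
        ((Measure.pi μ).prod ν) := by
    refine Measure.pi_eq fun s hs => ?_
    have hpre : (fun p : (Fin n → ℝ) × ℝ => Function.update p.1 j p.2) ⁻¹' Set.univ.pi s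
        = (Set.univ.pi (Function.update s j Set.univ)) ×ˢ s j := by
      ext ⟨x, t⟩
      simp only [Set.mem_preimage, Set.mem_univ_pi, Set.mem_prod]
      constructor
      · intro h
        refine ⟨fun i => ?_, by simpa using h j⟩
        by_cases hi : i = j
        · subst hi; simp
        · simpa [hi] using h i
      · rintro ⟨h1, h2⟩ i
        by_cases hi : i = j
        · subst hi; simpa using h2
        · simpa [hi] using h1 i
    rw [Measure.smul_apply, Measure.map_apply hmeas (MeasurableSet.univ_pi hs), hpre,
      Measure.prod_prod, Measure.pi_pi, smul_eq_mul]
    rw [← Finset.mul_prod_erase Finset.univ _ (Finset.mem_univ j),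
      ← Finset.mul_prod_erase Finset.univ
        (fun i => (Function.update μ j ν i) (s i)) (Finset.mem_univ j)]
    simp only [Function.update_self]
    have : ∏ x ∈ Finset.univ.erase j, (μ x) (Function.update s j Set.univ x)
        = ∏ x ∈ Finset.univ.erase j, (Function.update μ j ν x) (s x) := by
      refine Finset.prod_congr rfl fun i hi => ?_
      have := Finset.ne_of_mem_erase hi
      simp [this]
    rw [this, mul_assoc, ← mul_assoc, ENNReal.inv_mul_cancel hj hfin, one_mul, mul_comm]
  rw [key, smul_smul, ENNReal.mul_inv_cancel hj hfin, one_smul]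

lemma memLp_pi_of_continuous {n : ℕ} {a b : Fin n → ℝ} {μ : Fin n → Measure ℝ}
    [∀ i, IsFiniteMeasure (μ i)] (hμ : ∀ i, ∀ᵐ x ∂μ i, x ∈ Set.Icc (a i) (b i))
    {F : (Fin n → ℝ) → ℝ} (hF : Continuous F) (p : ENNReal) : MemLp F p (Measure.pi μ) := by
  obtain ⟨C, hC⟩ := (isCompact_univ_pi fun i => isCompact_Icc (a := a i) (b := b i)).exists_bound_of_continuousOn
    hF.continuousOn
  refine MemLp.of_bound hF.aestronglyMeasurable C ?_
  have : ∀ᵐ x ∂Measure.pi μ, ∀ i, x i ∈ Set.Icc (a i) (b i) := by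
    rw [ae_all_iff]
    exact fun i => Measure.tendsto_eval_ae_ae.eventually (hμ i)
  filter_upwards [this] with x hx
  exact hC x (fun i _ => hx i)

section Box

variable {n : ℕ} {a b : Fin n → ℝ}

lemma restrict_openBox (a b : Fin n → ℝ) :
    (volume : Measure (Fin n → ℝ)).restrict (openBox a b)
      = Measure.pi fun j => (volume : Measure ℝ).restrict (Set.Ioo (a j) (b j)) := by
  rw [openBox, volume_pi, Measure.restrict_pi_pi]

lemma ae_restrict_Ioo_mem_Icc (p q : ℝ) :
    ∀ᵐ x ∂(volume : Measure ℝ).restrict (Set.Ioo p q), x ∈ Set.Icc p q := by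
  filter_upwards [ae_restrict_mem measurableSet_Ioo] with x hx using Set.Ioo_subset_Icc_self hx

lemma isFiniteMeasure_update (a b : Fin n → ℝ) (j : Fin n) (ν : Measure ℝ) [IsFiniteMeasure ν]
    (i : Fin n) : IsFiniteMeasure (Function.update
      (fun j => (volume : Measure ℝ).restrict (Set.Ioo (a j) (b j))) j ν i) := by
  by_cases h : i = j
  · subst h; rw [Function.update_self]; infer_instance
  · rw [Function.update_of_ne h]; infer_instance

lemma ae_update_mem_Icc (j : Fin n) {ν : Measure ℝ}
    (hν : ∀ᵐ x ∂ν, x ∈ Set.Icc (a j) (b j)) (i : Fin n) :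
    ∀ᵐ x ∂(Function.update
      (fun j => (volume : Measure ℝ).restrict (Set.Ioo (a j) (b j))) j ν i),
      x ∈ Set.Icc (a i) (b i) := by
  by_cases h : i = j
  · subst h; rwa [Function.update_self]
  · rw [Function.update_of_ne h]; exact ae_restrict_Ioo_mem_Icc _ _

lemma memLp_openBox {F : (Fin n → ℝ) → ℝ} (hF : Continuous F) (p : ENNReal) :
    MemLp F p (volume.restrict (openBox a b)) := by
  rw [restrict_openBox]
  exact memLp_pi_of_continuous (fun i => ae_restrict_Ioo_mem_Icc _ _) hF p

lemma integrable_openBox {F : (Fin n → ℝ) → ℝ} (hF : Continuous F) :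
    Integrable F (volume.restrict (openBox a b)) :=
  memLp_one_iff_integrable.1 (memLp_openBox hF 1)

lemma memLp_faceMeasure {F : (Fin n → ℝ) → ℝ} (hF : Continuous F) (p : ENNReal) {i : Fin n}
    {c : ℝ} (hc : c ∈ Set.Icc (a i) (b i)) : MemLp F p (faceMeasure a b i c) := by
  have := isFiniteMeasure_update a b i (Measure.dirac c)
  refine memLp_pi_of_continuous (ae_update_mem_Icc i ?_) hF p
  exact (ae_dirac_iff (p := (· ∈ Set.Icc (a i) (b i))) measurableSet_Icc).2 hc

lemma integrable_surfaceMeasure (hab : ∀ i, a i < b i) {F : (Fin n → ℝ) → ℝ} (hF : Continuous F) :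
    Integrable F (surfaceMeasure a b) := by
  refine integrable_finsetSum_measure.2 fun i _ => Integrable.add_measure ?_ ?_
  · exact memLp_one_iff_integrable.1 (memLp_faceMeasure hF 1 ⟨le_rfl, (hab i).le⟩)
  · exact memLp_one_iff_integrable.1 (memLp_faceMeasure hF 1 ⟨(hab i).le, le_rfl⟩)

lemma memLp_surfaceMeasure (hab : ∀ i, a i < b i) {F : (Fin n → ℝ) → ℝ} (hF : Continuous F) :
    MemLp F 2 (surfaceMeasure a b) :=
  (memLp_two_iff_integrable_sq hF.aestronglyMeasurable).2
    (integrable_surfaceMeasure hab (hF.pow 2))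

/-- Fubini's theorem in one coordinate, keeping the box as a dummy domain of integration. -/
lemma integral_update (hab : ∀ i, a i < b i) (j : Fin n) {ν : Measure ℝ} [IsFiniteMeasure ν]
    (hν : ∀ᵐ x ∂ν, x ∈ Set.Icc (a j) (b j)) {F : (Fin n → ℝ) → ℝ} (hF : Continuous F) :
    ∫ x in openBox a b, ∫ t, F (Function.update x j t) ∂ν
      = (b j - a j) * ∫ x, F x ∂(Measure.pi (Function.update
          (fun j => (volume : Measure ℝ).restrict (Set.Ioo (a j) (b j))) j ν)) := by
  have hfm := isFiniteMeasure_update a b j ν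
  have hvol : (volume : Measure ℝ).restrict (Set.Ioo (a j) (b j)) Set.univ
      = ENNReal.ofReal (b j - a j) := by simp
  have hpos := sub_pos.2 (hab j)
  have hne : (volume : Measure ℝ).restrict (Set.Ioo (a j) (b j)) Set.univ ≠ 0 := by
    rw [hvol]; simpa using hab j
  have hmap := map_update_pi_prod
    (fun j => (volume : Measure ℝ).restrict (Set.Ioo (a j) (b j))) ν j hne
  have hcont : Continuous fun p : (Fin n → ℝ) × ℝ => Function.update p.1 j p.2 :=
    continuous_fst.update j continuous_snd
  have hint : Integrable F (Measure.pi (Function.update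
          (fun j => (volume : Measure ℝ).restrict (Set.Ioo (a j) (b j))) j ν)) :=
    memLp_one_iff_integrable.1 (memLp_pi_of_continuous (ae_update_mem_Icc j hν) hF 1)
  have hint' := hint.smul_measure (measure_ne_top
    ((volume : Measure ℝ).restrict (Set.Ioo (a j) (b j))) Set.univ)
  rw [← hmap, integrable_map_measure hF.aestronglyMeasurable hcont.aemeasurable] at hint'
  have e := integral_map (μ := (Measure.pi fun j =>
    (volume : Measure ℝ).restrict (Set.Ioo (a j) (b j))).prod ν) hcont.aemeasurable
    (hF.aestronglyMeasurable (μ := Measure.map _ _))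
  rw [hmap, integral_smul_measure, integral_prod (fun p : (Fin n → ℝ) × ℝ => F (Function.update p.1 j p.2)) hint', ← restrict_openBox, hvol,
    ENNReal.toReal_ofReal hpos.le] at e
  exact e.symm

lemma integral_integral_update (hab : ∀ i, a i < b i) (j : Fin n) {F : (Fin n → ℝ) → ℝ}
    (hF : Continuous F) :
    ∫ x in openBox a b, ∫ t in (a j)..(b j), F (Function.update x j t)
      = (b j - a j) * ∫ x in openBox a b, F x := by
  have := integral_update hab j (ae_restrict_Ioo_mem_Icc (a j) (b j)) hF
  rw [Function.update_eq_self, ← restrict_openBox] at this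
  rw [← this]
  simp only [intervalIntegral.integral_of_le (hab j).le, integral_Ioc_eq_integral_Ioo]

lemma integral_faceMeasure (hab : ∀ i, a i < b i) (j : Fin n) {c : ℝ}
    (hc : c ∈ Set.Icc (a j) (b j)) {F : (Fin n → ℝ) → ℝ} (hF : Continuous F) :
    ∫ x in openBox a b, F (Function.update x j c)
      = (b j - a j) * ∫ x, F x ∂faceMeasure a b j c := by
  have := integral_update hab j (ν := Measure.dirac c)
    ((ae_dirac_iff (p := (· ∈ Set.Icc (a j) (b j))) measurableSet_Icc).2 hc) hF
  simpa [integral_dirac, faceMeasure] using this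

lemma integral_surfaceMeasure (hab : ∀ i, a i < b i) {F : (Fin n → ℝ) → ℝ} (hF : Continuous F) :
    ∫ x, F x ∂surfaceMeasure a b
      = ∑ i, (∫ x, F x ∂faceMeasure a b i (a i) + ∫ x, F x ∂faceMeasure a b i (b i)) := by
  have ha : ∀ i, Integrable F (faceMeasure a b i (a i)) := fun i =>
    memLp_one_iff_integrable.1 (memLp_faceMeasure hF 1 ⟨le_rfl, (hab i).le⟩)
  have hb : ∀ i, Integrable F (faceMeasure a b i (b i)) := fun i =>
    memLp_one_iff_integrable.1 (memLp_faceMeasure hF 1 ⟨(hab i).le, le_rfl⟩)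
  rw [surfaceMeasure, integral_finsetSum_measure fun i _ => (ha i).add_measure (hb i)]
  exact Finset.sum_congr rfl fun i _ => integral_add_measure (ha i) (hb i)

end Box

/-- For commuting symmetric idempotents `P i` on a space with a positive semidefinite form, there
is a symmetric idempotent `Q` onto the common fixed space whose energy defect is at most the sum
of those of the `P i` (the Efron–Stein inequality). -/
lemma exists_joint_projection {V ι : Type*} [AddCommGroup V] [Module ℝ V]
    (B : V →ₗ[ℝ] V →ₗ[ℝ] ℝ) (hB : ∀ x, 0 ≤ B x x) (P : ι → V →ₗ[ℝ] V)
    (hsymm : ∀ i x y, B (P i x) y = B x (P i y)) (hidem : ∀ i x, P i (P i x) = P i x)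
    (hcomm : ∀ i j x, P i (P j x) = P j (P i x)) (s : Finset ι) :
    ∃ Q : V →ₗ[ℝ] V, (∀ x y, B (Q x) y = B x (Q y)) ∧ (∀ x, Q (Q x) = Q x) ∧
      (∀ i x, Q (P i x) = P i (Q x)) ∧ (∀ i ∈ s, ∀ x, P i (Q x) = Q x) ∧
      (∀ x, (∀ i ∈ s, P i x = x) → Q x = x) ∧
      ∀ x, B x x - B (Q x) x ≤ ∑ i ∈ s, (B x x - B (P i x) x) := by
  classical
  induction s using Finset.induction_on with
  | empty => exact ⟨LinearMap.id, by simp⟩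
  | insert i s hi ih =>
    obtain ⟨Q, q1, q2, q3, q4, q5, q6⟩ := ih
    refine ⟨P i ∘ₗ Q, ?_, ?_, ?_, ?_, ?_, ?_⟩
    · intro x y
      simp [hsymm, q1, q3]
    · intro x
      simp [← q3, q2, hidem]
    · intro j x
      simp [q3, hcomm i j]
    · intro j hj x
      rcases Finset.mem_insert.1 hj with rfl | hj
      · simp [hidem]
      · simp [hcomm j i, q4 j hj]
    · intro x hx
      simp [q5 x fun j hj => hx j (Finset.mem_insert_of_mem hj), hx i (Finset.mem_insert_self _ _)]
    · intro x
      rw [Finset.sum_insert hi]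
      set y := (x - Q x) - P i (x - Q x) with hy
      have hQ : B (Q x) (Q x) = B (Q x) x := by rw [← q1, q2]
      have e1 : B (P i (x - Q x)) (P i (x - Q x)) = B (P i (x - Q x)) (x - Q x) := by
        rw [← hsymm, hidem]
      have e2 : B (x - Q x) (P i (x - Q x)) = B (P i (x - Q x)) (x - Q x) := (hsymm _ _ _).symm
      have e3 : B (P i (x - Q x)) (Q x) = 0 := by
        rw [← q1, q3, map_sub, q2, sub_self, map_zero, map_zero, LinearMap.zero_apply]
      have e4 : B (x - Q x) (Q x) = 0 := by
        rw [← q1, map_sub, q2, sub_self, map_zero, LinearMap.zero_apply]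
      have hyy : B y y = B x x - B (Q x) x - (B (P i x) x - B (P i (Q x)) x) := by
        have : B y y = B (x - Q x) (x - Q x) - B (P i (x - Q x)) (x - Q x) := by
          rw [hy]
          simp only [map_sub B (x - Q x), LinearMap.sub_apply, map_sub (B (x - Q x)) (x - Q x),
            map_sub (B (P i (x - Q x))) (x - Q x), e1, e2]
          ring
        rw [this, map_sub (B (x - Q x)) x, e4, map_sub (B (P i (x - Q x))) x, e3]
        simp only [map_sub, LinearMap.sub_apply]
        ring
      have := hB y
      have := q6 x
      simp only [LinearMap.comp_apply]
      linarith

/-- The component of `f` along `u` on the line through `x` in direction `j`. -/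
noncomputable def fiberCoeff {n : ℕ} (p q : ℝ) (u : ℝ → ℝ) (j : Fin n) (f : (Fin n → ℝ) → ℝ)
    (x : Fin n → ℝ) : ℝ :=
  ∫ t in p..q, f (Function.update x j t) * u t

lemma continuous_update_const {n : ℕ} (j : Fin n) (c : ℝ) :
    Continuous fun x : Fin n → ℝ => Function.update x j c :=
  continuous_id.update j continuous_const

lemma continuous_integral_update {n : ℕ} (p q : ℝ) (j : Fin n) {F : (Fin n → ℝ) → ℝ}
    (hF : Continuous F) : Continuous fun x => ∫ t in p..q, F (Function.update x j t) := by
  refine intervalIntegral.continuous_parametric_intervalIntegral_of_continuous' ?_ p q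
  have : Continuous fun y : (Fin n → ℝ) × ℝ => Function.update y.1 j y.2 :=
    continuous_fst.update j continuous_snd
  exact hF.comp this

lemma continuous_fiberCoeff {n : ℕ} {p q : ℝ} {u : ℝ → ℝ} (hu : Continuous u) (j : Fin n)
    {f : (Fin n → ℝ) → ℝ} (hf : Continuous f) : Continuous (fiberCoeff p q u j f) := by
  refine intervalIntegral.continuous_parametric_intervalIntegral_of_continuous' ?_ p q
  have : Continuous fun y : (Fin n → ℝ) × ℝ => Function.update y.1 j y.2 :=
    continuous_fst.update j continuous_snd
  exact (hf.comp this).mul (hu.comp continuous_snd)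

lemma fiberCoeff_update {n : ℕ} (p q : ℝ) (u : ℝ → ℝ) (j : Fin n) (f : (Fin n → ℝ) → ℝ)
    (x : Fin n → ℝ) (s : ℝ) :
    fiberCoeff p q u j f (Function.update x j s) = fiberCoeff p q u j f x := by
  simp [fiberCoeff]

/-- The `L²` projection, in the `j`-th coordinate only, onto the line spanned by `u`. -/
noncomputable def fiberProj {n : ℕ} (p q : ℝ) (u : C(ℝ, ℝ)) (j : Fin n) :
    C(Fin n → ℝ, ℝ) →ₗ[ℝ] C(Fin n → ℝ, ℝ) where
  toFun f := ⟨fun x => u (x j) / (∫ t in p..q, u t ^ 2) * fiberCoeff p q u j f x,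
    (((u.continuous.comp (continuous_apply j)).div_const _).mul
      (continuous_fiberCoeff u.continuous j f.continuous))⟩
  map_add' f g := by
    ext x
    have h1 : ∀ f : C(Fin n → ℝ, ℝ), IntervalIntegrable
        (fun t => f (Function.update x j t) * u t) volume p q := fun f =>
      ((f.continuous.comp (continuous_const.update j continuous_id)).mul
        u.continuous).intervalIntegrable _ _
    simp only [fiberCoeff, ContinuousMap.coe_mk, ContinuousMap.add_apply, add_mul]
    rw [intervalIntegral.integral_add (h1 f) (h1 g)]
    ring
  map_smul' c f := by
    ext x
    simp only [fiberCoeff, ContinuousMap.coe_mk, ContinuousMap.smul_apply, smul_eq_mul,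
      RingHom.id_apply, mul_assoc, intervalIntegral.integral_const_mul]
    ring

lemma fiberProj_apply {n : ℕ} (p q : ℝ) (u : C(ℝ, ℝ)) (j : Fin n) (f : C(Fin n → ℝ, ℝ))
    (x : Fin n → ℝ) :
    fiberProj p q u j f x = u (x j) / (∫ t in p..q, u t ^ 2) * fiberCoeff p q u j f x := rfl

lemma fiberProj_idem {n : ℕ} {p q : ℝ} {u : C(ℝ, ℝ)} (hu : (∫ t in p..q, u t ^ 2) ≠ 0)
    (j : Fin n) (f : C(Fin n → ℝ, ℝ)) :
    fiberProj p q u j (fiberProj p q u j f) = fiberProj p q u j f := by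
  ext x
  have : fiberCoeff p q u j (fiberProj p q u j f) x = fiberCoeff p q u j f x := by
    have e : ∀ t, fiberProj p q u j f (Function.update x j t) * u t
        = (fiberCoeff p q u j f x / ∫ t in p..q, u t ^ 2) * u t ^ 2 := by
      intro t
      rw [fiberProj_apply, fiberCoeff_update, Function.update_self]
      ring
    rw [fiberCoeff]
    simp only [e]
    rw [intervalIntegral.integral_const_mul, div_mul_cancel₀ _ hu]
  rw [fiberProj_apply, this, fiberProj_apply]

lemma fiberProj_comm {n : ℕ} {p q : Fin n → ℝ} {u : Fin n → C(ℝ, ℝ)}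
    (i j : Fin n) (f : C(Fin n → ℝ, ℝ)) :
    fiberProj (p i) (q i) (u i) i (fiberProj (p j) (q j) (u j) j f)
      = fiberProj (p j) (q j) (u j) j (fiberProj (p i) (q i) (u i) i f) := by
  rcases eq_or_ne i j with rfl | hij
  · rfl
  have expand : ∀ (i j : Fin n), i ≠ j → ∀ x, fiberProj (p i) (q i) (u i) i
      (fiberProj (p j) (q j) (u j) j f) x = u i (x i) / (∫ t in (p i)..(q i), u i t ^ 2)
        * (u j (x j) / (∫ t in (p j)..(q j), u j t ^ 2)) * ∫ s in (p i)..(q i), ∫ t in (p j)..(q j),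
          f (Function.update (Function.update x i s) j t) * u j t * u i s := by
    intro i j hij x
    rw [fiberProj_apply, mul_assoc]
    congr 1
    rw [fiberCoeff, ← intervalIntegral.integral_const_mul]
    congr 1
    ext s
    rw [fiberProj_apply, Function.update_of_ne hij.symm, mul_assoc, fiberCoeff,
      intervalIntegral.integral_mul_const]
  ext x
  rw [expand i j hij, expand j i hij.symm, intervalIntegral_intervalIntegral_swap]
  · rw [mul_comm (u i (x i) / _)]
    congr 1
    simp only [Function.update_comm hij]
    congr 1; ext t; congr 1; ext s
    ring
  · have hc : Continuous (Function.uncurry fun s t =>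
        f (Function.update (Function.update x i s) j t) * u j t * u i s) := by
      have h1 : Continuous fun y : ℝ × ℝ => Function.update x i y.1 :=
        continuous_const.update i continuous_fst
      have : Continuous fun y : ℝ × ℝ => Function.update (Function.update x i y.1) j y.2 :=
        h1.update j continuous_snd
      exact ((f.continuous.comp this).mul ((u j).continuous.comp continuous_snd)).mul
        ((u i).continuous.comp continuous_fst)
    refine IntegrableOn.mono_set (t := Set.uIcc (p i) (q i) ×ˢ Set.uIcc (p j) (q j))
      (hc.continuousOn.integrableOn_compact
      (isCompact_uIcc.prod isCompact_uIcc)) ?_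
    exact Set.prod_mono Set.uIoc_subset_uIcc Set.uIoc_subset_uIcc

lemma eq_of_fiberProj_eq_self {n : ℕ} {p q : ℝ} {u : C(ℝ, ℝ)} {j : Fin n} {f : C(Fin n → ℝ, ℝ)}
    (hf : fiberProj p q u j f = f) (x : Fin n → ℝ) (m : ℝ) :
    f x * u m = f (Function.update x j m) * u (x j) := by
  have h1 := DFunLike.congr_fun hf x
  have h2 := DFunLike.congr_fun hf (Function.update x j m)
  rw [fiberProj_apply] at h1 h2
  rw [fiberCoeff_update, Function.update_self] at h2
  rw [← h1, ← h2]
  ring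

lemma eq_prod_of_fiberProj_eq_self {n : ℕ} {p q : Fin n → ℝ} {u : Fin n → C(ℝ, ℝ)}
    {f : C(Fin n → ℝ, ℝ)} (hf : ∀ j, fiberProj (p j) (q j) (u j) j f = f) (x m : Fin n → ℝ) :
    f x * ∏ j, u j (m j) = f m * ∏ j, u j (x j) := by
  classical
  have key : ∀ s : Finset (Fin n),
      f x * ∏ j ∈ s, u j (m j) = f (s.piecewise m x) * ∏ j ∈ s, u j (x j) := by
    intro s
    induction s using Finset.induction_on with
    | empty => simp
    | insert i s hi ih =>
      rw [Finset.prod_insert hi, Finset.prod_insert hi, Finset.piecewise_insert]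
      have := eq_of_fiberProj_eq_self (hf i) (s.piecewise m x) (m i)
      rw [Finset.piecewise_eq_of_notMem _ _ _ hi] at this
      linear_combination (u i (m i)) * ih + (∏ j ∈ s, u j (x j)) * this
  simpa using key Finset.univ

section Box

variable {n : ℕ} {a b : Fin n → ℝ}

/-- The `L²(B)` inner product of continuous functions. -/
noncomputable def boxForm (a b : Fin n → ℝ) : C(Fin n → ℝ, ℝ) →ₗ[ℝ] C(Fin n → ℝ, ℝ) →ₗ[ℝ] ℝ :=
  LinearMap.mk₂ ℝ (fun f g => ∫ x in openBox a b, f x * g x)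
    (fun f f' g => by
      simp only [ContinuousMap.add_apply, add_mul]
      exact integral_add (integrable_openBox (f.continuous.mul g.continuous))
        (integrable_openBox (f'.continuous.mul g.continuous)))
    (fun c f g => by
      simp only [ContinuousMap.smul_apply, smul_eq_mul, mul_assoc, integral_const_mul])
    (fun f g g' => by
      simp only [ContinuousMap.add_apply, mul_add]
      exact integral_add (integrable_openBox (f.continuous.mul g.continuous))
        (integrable_openBox (f.continuous.mul g'.continuous)))
    (fun c f g => by
      simp only [ContinuousMap.smul_apply, smul_eq_mul, mul_left_comm, integral_const_mul])

lemma boxForm_apply (f g : C(Fin n → ℝ, ℝ)) :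
    boxForm a b f g = ∫ x in openBox a b, f x * g x := rfl

lemma boxForm_comm (f g : C(Fin n → ℝ, ℝ)) : boxForm a b f g = boxForm a b g f := by
  simp only [boxForm_apply, mul_comm]

lemma boxForm_fiberProj (hab : ∀ i, a i < b i) (u : C(ℝ, ℝ)) (j : Fin n)
    (f g : C(Fin n → ℝ, ℝ)) :
    (b j - a j) * boxForm a b (fiberProj (a j) (b j) u j f) g
      = ∫ x in openBox a b, fiberCoeff (a j) (b j) u j f x * fiberCoeff (a j) (b j) u j g x
        / ∫ t in (a j)..(b j), u t ^ 2 := by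
  rw [boxForm_apply, ← integral_integral_update hab j
    (F := fun x => fiberProj (a j) (b j) u j f x * g x)
    ((ContinuousMap.continuous _).mul g.continuous)]
  congr 1
  ext x
  have e : ∀ t, fiberProj (a j) (b j) u j f (Function.update x j t) * g (Function.update x j t)
      = (fiberCoeff (a j) (b j) u j f x / ∫ t in (a j)..(b j), u t ^ 2)
        * (g (Function.update x j t) * u t) := by
    intro t
    rw [fiberProj_apply, fiberCoeff_update, Function.update_self]
    ring
  simp only [e]
  rw [intervalIntegral.integral_const_mul, ← fiberCoeff]
  ring

lemma boxForm_fiberProj_comm (hab : ∀ i, a i < b i) (u : C(ℝ, ℝ)) (j : Fin n)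
    (f g : C(Fin n → ℝ, ℝ)) :
    boxForm a b (fiberProj (a j) (b j) u j f) g = boxForm a b f (fiberProj (a j) (b j) u j g) := by
  have h1 := boxForm_fiberProj hab u j f g
  have h2 := boxForm_fiberProj hab u j g f
  rw [boxForm_comm f]
  have : (b j - a j) ≠ 0 := (sub_pos.2 (hab j)).ne'
  apply mul_left_cancel₀ this
  rw [h1, h2]
  simp only [mul_comm]

lemma hasDerivAt_comp_update {φ : (Fin n → ℝ) → ℝ} (hφ : Differentiable ℝ φ) (x : Fin n → ℝ)
    (j : Fin n) (t : ℝ) :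
    HasDerivAt (fun t => φ (Function.update x j t)) (partialDeriv j φ (Function.update x j t)) t :=
  (hφ _).hasFDerivAt.comp_hasDerivAt t (hasDerivAt_update x j t)

lemma contDiff_comp_update {k : ℕ∞} {φ : (Fin n → ℝ) → ℝ} (hφ : ContDiff ℝ k φ) (x : Fin n → ℝ)
    (j : Fin n) : ContDiff ℝ k (fun t => φ (Function.update x j t)) :=
  hφ.comp (contDiff_update k x j)

lemma continuous_partialDeriv {φ : (Fin n → ℝ) → ℝ} (hφ : ContDiff ℝ 1 φ) (j : Fin n) :
    Continuous (partialDeriv j φ) :=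
  (hφ.continuous_fderiv (by simp)).clm_apply continuous_const

/-- Integration of a one-dimensional identity of energies over all lines in direction `j`. -/
lemma integral_fiber_energy (hab : ∀ i, a i < b i) (j : Fin n) {F G : (Fin n → ℝ) → ℝ}
    (hF : Continuous F) (hG : Continuous G) (α : ℝ) :
    ∫ x in openBox a b, ((∫ t in (a j)..(b j), F (Function.update x j t))
        + α * (G (Function.update x j (a j)) + G (Function.update x j (b j))))
      = (b j - a j) * ((∫ x in openBox a b, F x) + α * ((∫ x, G x ∂faceMeasure a b j (a j))
        + ∫ x, G x ∂faceMeasure a b j (b j))) := by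
  have i1 : Integrable (fun x => ∫ t in (a j)..(b j), F (Function.update x j t))
      (volume.restrict (openBox a b)) := integrable_openBox (continuous_integral_update _ _ j hF)
  have i2 : ∀ c, Integrable (fun x => G (Function.update x j c)) (volume.restrict (openBox a b)) :=
    fun c => integrable_openBox (hG.comp (continuous_update_const j c))
  have i3 : Integrable (fun x => α * (G (Function.update x j (a j)) + G (Function.update x j (b j))))
      (volume.restrict (openBox a b)) := ((i2 _).add (i2 _)).const_mul α
  rw [integral_add i1 i3, integral_const_mul,
    integral_add (i2 _) (i2 _), integral_integral_update hab j hF,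
    integral_faceMeasure hab j ⟨le_rfl, (hab j).le⟩ hG,
    integral_faceMeasure hab j ⟨(hab j).le, le_rfl⟩ hG]
  ring

variable {α : ℝ} {μ ν m : Fin n → ℝ} {u w : Fin n → ℝ → ℝ}

lemma fiber_gap_le (hp : ∀ j, RobinPair α (a j) (b j) (μ j) (ν j) (m j) (u j) (w j))
    {φ : (Fin n → ℝ) → ℝ} (hφ : ContDiff ℝ 1 φ) (j : Fin n) (U : C(ℝ, ℝ)) (hU : ⇑U = u j)
    (f : C(Fin n → ℝ, ℝ)) (hf : ⇑f = φ) :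
    (ν j - μ j) * (boxForm a b f f - boxForm a b (fiberProj (a j) (b j) U j f) f)
      ≤ (∫ x in openBox a b, partialDeriv j φ x ^ 2)
        + α * ((∫ x, φ x ^ 2 ∂faceMeasure a b j (a j)) + ∫ x, φ x ^ 2 ∂faceMeasure a b j (b j))
        - μ j * boxForm a b f f := by
  have hab : ∀ i, a i < b i := fun i => (hp i).lt_mid.trans (hp i).mid_lt
  have hL : 0 < b j - a j := sub_pos.2 (hab j)
  have hc := hφ.continuous
  have hdc := continuous_partialDeriv hφ j
  have hφd : Differentiable ℝ φ := hφ.differentiable (by simp)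
  have hucont := (hp j).fst.continuous
  have hsq : Continuous fun x => φ x ^ 2 := hc.pow 2
  have hdsq : Continuous fun x => partialDeriv j φ x ^ 2 := hdc.pow 2
  have c1 := continuous_integral_update (a j) (b j) j hsq
  have c2 := continuous_integral_update (a j) (b j) j hdsq
  have c3 : ∀ c, Continuous fun x => φ (Function.update x j c) ^ 2 := fun c =>
    hsq.comp (continuous_update_const j c)
  have hfc := continuous_fiberCoeff (p := a j) (q := b j) hucont j hc
  have key : ∀ x : Fin n → ℝ, (ν j - μ j) * ((∫ t in (a j)..(b j), φ (Function.update x j t) ^ 2)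
      - fiberCoeff (a j) (b j) (u j) j φ x * fiberCoeff (a j) (b j) (u j) j φ x
        / ∫ t in (a j)..(b j), u j t ^ 2)
      ≤ ((∫ t in (a j)..(b j), partialDeriv j φ (Function.update x j t) ^ 2)
        + α * (φ (Function.update x j (a j)) ^ 2 + φ (Function.update x j (b j)) ^ 2))
        - μ j * ∫ t in (a j)..(b j), φ (Function.update x j t) ^ 2 := by
    intro x
    have := (hp j).gap_le_energy (contDiff_comp_update (k := 1) hφ x j)
    simp only [(hasDerivAt_comp_update hφd x j _).deriv] at this
    rw [← sq]
    exact this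
  have c4 : Continuous fun x => fiberCoeff (a j) (b j) (u j) j φ x
      * fiberCoeff (a j) (b j) (u j) j φ x / ∫ t in (a j)..(b j), u j t ^ 2 := by fun_prop
  have c5 : Continuous fun x => (∫ t in (a j)..(b j), partialDeriv j φ (Function.update x j t) ^ 2)
        + α * (φ (Function.update x j (a j)) ^ 2 + φ (Function.update x j (b j)) ^ 2) :=
    c2.add (continuous_const.mul ((c3 _).add (c3 _)))
  have c6 : Continuous fun x => μ j * ∫ t in (a j)..(b j), φ (Function.update x j t) ^ 2 :=
    continuous_const.mul c1
  have hmono := integral_mono (μ := volume.restrict (openBox a b))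
    (integrable_openBox (continuous_const.mul (c1.sub c4))) (integrable_openBox (c5.sub c6)) key
  have e0 : (∫ x in openBox a b, fiberCoeff (a j) (b j) (u j) j φ x
      * fiberCoeff (a j) (b j) (u j) j φ x / ∫ t in (a j)..(b j), u j t ^ 2)
      = (b j - a j) * boxForm a b (fiberProj (a j) (b j) U j f) f := by
    rw [boxForm_fiberProj hab, hU, hf]
  have e1 : (b j - a j) * boxForm a b f f
      = ∫ x in openBox a b, ∫ t in (a j)..(b j), φ (Function.update x j t) ^ 2 := by
    rw [integral_integral_update hab j hsq, boxForm_apply, hf]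
    simp only [sq]
  have f1 := integral_sub (integrable_openBox (a := a) (b := b) c1) (integrable_openBox c4)
  have f2 := integral_sub (integrable_openBox (a := a) (b := b) c5) (integrable_openBox c6)
  have f3 := integral_fiber_energy hab j hdsq hsq α
  rw [integral_const_mul] at f2
  simp only [Pi.mul_apply, Pi.sub_apply] at hmono
  rw [integral_const_mul, f1, f2, e0, ← e1, f3] at hmono
  refine le_of_mul_le_mul_left ?_ hL
  linear_combination hmono

/-- The spectral gap inequality on a box, for functions smooth up to the boundary. -/
theorem box_gap_le (hp : ∀ j, RobinPair α (a j) (b j) (μ j) (ν j) (m j) (u j) (w j)) {γ : ℝ}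
    (hγ : ∀ j, γ ≤ ν j - μ j) (hγ0 : 0 ≤ γ) {φ : (Fin n → ℝ) → ℝ} (hφ : ContDiff ℝ 1 φ) :
    γ * ((∫ x in openBox a b, φ x ^ 2) - (∫ x in openBox a b, φ x * ∏ j, u j (x j)) ^ 2
        / ∫ x in openBox a b, (∏ j, u j (x j)) ^ 2)
      ≤ (∑ j, ∫ x in openBox a b, partialDeriv j φ x ^ 2)
        + α * (∫ x, φ x ^ 2 ∂surfaceMeasure a b) - (∑ j, μ j) * ∫ x in openBox a b, φ x ^ 2 := by
  have hab : ∀ i, a i < b i := fun i => (hp i).lt_mid.trans (hp i).mid_lt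
  let v : Fin n → C(ℝ, ℝ) := fun j => ⟨u j, (hp j).fst.continuous⟩
  let f : C(Fin n → ℝ, ℝ) := ⟨φ, hφ.continuous⟩
  let W : C(Fin n → ℝ, ℝ) := ⟨fun x => ∏ j, u j (x j),
    continuous_finsetProd _ fun j _ => (hp j).fst.continuous.comp (continuous_apply j)⟩
  have hN : ∀ j, (∫ t in (a j)..(b j), v j t ^ 2) ≠ 0 := fun j => (hp j).integral_sq_pos.ne'
  obtain ⟨Q, q1, q2, -, q4, q5, q6⟩ := exists_joint_projection (boxForm a b)
    (fun f => by rw [boxForm_apply]; exact integral_nonneg fun x => mul_self_nonneg _)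
    (fun j => fiberProj (a j) (b j) (v j) j) (fun j => boxForm_fiberProj_comm hab (v j) j)
    (fun j => fiberProj_idem (hN j) j) (fun i j => fiberProj_comm i j) Finset.univ
  have hWfix : ∀ j, fiberProj (a j) (b j) (v j) j W = W := by
    intro j
    ext x
    have e : ∀ t, W (Function.update x j t) * v j t
        = (∏ i ∈ Finset.univ.erase j, u i (x i)) * v j t ^ 2 := by
      intro t
      have : ∏ i ∈ Finset.univ.erase j, u i (Function.update x j t i)
          = ∏ i ∈ Finset.univ.erase j, u i (x i) :=
        Finset.prod_congr rfl fun i hi => by rw [Function.update_of_ne (Finset.ne_of_mem_erase hi)]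
      simp only [W, ContinuousMap.coe_mk]
      rw [← Finset.mul_prod_erase _ _ (Finset.mem_univ j), this, Function.update_self]
      simp only [v, ContinuousMap.coe_mk]
      ring
    rw [fiberProj_apply, fiberCoeff]
    simp only [e]
    rw [intervalIntegral.integral_const_mul]
    have : W x = u j (x j) * ∏ i ∈ Finset.univ.erase j, u i (x i) :=
      (Finset.mul_prod_erase _ (fun i => u i (x i)) (Finset.mem_univ j)).symm
    rw [this]
    have := hN j
    field_simp
    exact mul_comm _ _
  have hQW : Q W = W := q5 W fun j _ => hWfix j
  obtain ⟨c, hc⟩ : ∃ c : ℝ, Q f = c • W := by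
    refine ⟨Q f m / ∏ j, u j (m j), ?_⟩
    ext x
    have h := eq_prod_of_fiberProj_eq_self (fun j => q4 j (Finset.mem_univ j) f) x m
    have hne : ∏ j, u j (m j) ≠ 0 := Finset.prod_ne_zero_iff.2 fun j _ => (hp j).fst_mid
    simp only [v, ContinuousMap.coe_mk] at h
    simp only [ContinuousMap.smul_apply, smul_eq_mul, W, ContinuousMap.coe_mk]
    field_simp
    exact h
  have hfW : boxForm a b f W = c * boxForm a b W W := by
    rw [← hQW, ← q1, hc, hQW, map_smul, LinearMap.smul_apply, smul_eq_mul]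
  have hWf : boxForm a b (Q f) f = c * boxForm a b f W := by
    rw [hc, map_smul, LinearMap.smul_apply, smul_eq_mul, boxForm_comm]
  have hproj : boxForm a b (Q f) f = boxForm a b f W ^ 2 / boxForm a b W W := by
    rw [hWf, hfW]
    by_cases h0 : boxForm a b W W = 0
    · simp [h0]
    · field_simp
  have hsum : γ * (boxForm a b f f - boxForm a b (Q f) f) ≤ ∑ j,
      ((∫ x in openBox a b, partialDeriv j φ x ^ 2)
        + α * ((∫ x, φ x ^ 2 ∂faceMeasure a b j (a j)) + ∫ x, φ x ^ 2 ∂faceMeasure a b j (b j))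
        - μ j * boxForm a b f f) := by
    refine (mul_le_mul_of_nonneg_left (q6 f) hγ0).trans ?_
    rw [Finset.mul_sum]
    refine Finset.sum_le_sum fun j _ => ?_
    refine le_trans ?_ (fiber_gap_le hp hφ j (v j) rfl f rfl)
    refine mul_le_mul_of_nonneg_right (hγ j) ?_
    set y := f - fiberProj (a j) (b j) (v j) j f
    have hy : 0 ≤ boxForm a b y y := by
      rw [boxForm_apply]; exact integral_nonneg fun x => mul_self_nonneg _
    have e1 : boxForm a b (fiberProj (a j) (b j) (v j) j f) (fiberProj (a j) (b j) (v j) j f)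
        = boxForm a b (fiberProj (a j) (b j) (v j) j f) f := by
      rw [← boxForm_fiberProj_comm hab, fiberProj_idem (hN j)]
    have e2 := (boxForm_fiberProj_comm hab (v j) j f f).symm
    simp only [y, map_sub, LinearMap.sub_apply, e1, e2] at hy
    linarith
  rw [hproj, Finset.sum_sub_distrib, Finset.sum_add_distrib, ← Finset.mul_sum, ← Finset.sum_mul,
    ← integral_surfaceMeasure hab (F := fun x => φ x ^ 2) (hφ.continuous.pow 2)] at hsum
  simp only [boxForm_apply, ← sq] at hsum
  exact hsum

end Box

lemma inner_toLp {X : Type*} [MeasurableSpace X] {ρ : Measure X} {f g : X → ℝ}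
    (hf : MemLp f 2 ρ) (hg : MemLp g 2 ρ) :
    inner ℝ (hf.toLp f) (hg.toLp g) = ∫ x, f x * g x ∂ρ := by
  rw [L2.inner_def]
  refine integral_congr_ae ?_
  filter_upwards [hf.coeFn_toLp, hg.coeFn_toLp] with x h1 h2
  rw [h1, h2]
  simp [mul_comm]

lemma tendsto_toLp_of_eLpNorm {X : Type*} [MeasurableSpace X] {ρ : Measure X} {f : ℕ → X → ℝ}
    (hf : ∀ k, MemLp (f k) 2 ρ) {u : Lp ℝ 2 ρ}
    (h : Tendsto (fun k => eLpNorm (fun x => f k x - u x) 2 ρ) atTop (𝓝 0)) :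
    Tendsto (fun k => (hf k).toLp (f k)) atTop (𝓝 u) := by
  have := (Lp.tendsto_Lp_iff_tendsto_eLpNorm'' f hf u (Lp.memLp u)).2 h
  rwa [Lp.toLp_coeFn] at this

lemma eLpNorm_sub_toLp {X : Type*} [MeasurableSpace X] {ρ : Measure X} {f : X → ℝ}
    (hf : MemLp f 2 ρ) : eLpNorm (fun x => f x - hf.toLp f x) 2 ρ = 0 := by
  rw [eLpNorm_congr_ae (g := 0), eLpNorm_zero]
  filter_upwards [hf.coeFn_toLp] with x hx
  simp [hx]

section Box

variable {n : ℕ} {a b : Fin n → ℝ} {α : ℝ}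

lemma ContDiff.continuous_partialDeriv {φ : (Fin n → ℝ) → ℝ} (hφ : ContDiff ℝ ∞ φ) (j : Fin n) :
    Continuous (partialDeriv j φ) :=
  _root_.continuous_partialDeriv (hφ.of_le (by simp)) j

/-- The class in `L²(B)` of a continuous function. -/
noncomputable def boxLp (a b : Fin n → ℝ) {φ : (Fin n → ℝ) → ℝ} (hφ : Continuous φ) : L2Box a b :=
  (memLp_openBox hφ 2).toLp φ

/-- The class in `L²(∂B)` of a continuous function. -/
noncomputable def boundaryLp (hab : ∀ i, a i < b i) {φ : (Fin n → ℝ) → ℝ} (hφ : Continuous φ) :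
    L2Boundary a b :=
  (memLp_surfaceMeasure hab hφ).toLp φ

lemma inner_boxLp {φ ψ : (Fin n → ℝ) → ℝ} (hφ : Continuous φ) (hψ : Continuous ψ) :
    inner ℝ (boxLp a b hφ) (boxLp a b hψ) = ∫ x in openBox a b, φ x * ψ x := inner_toLp _ _

lemma inner_boundaryLp (hab : ∀ i, a i < b i) {φ ψ : (Fin n → ℝ) → ℝ} (hφ : Continuous φ)
    (hψ : Continuous ψ) :
    inner ℝ (boundaryLp hab hφ) (boundaryLp hab hψ) = ∫ x, φ x * ψ x ∂surfaceMeasure a b :=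
  inner_toLp _ _

lemma IsTrace.exists_tendsto (hab : ∀ i, a i < b i) {u : L2Box a b} {G : Fin n → L2Box a b}
    {τ : L2Boundary a b} (h : IsTrace u G τ) :
    ∃ (φ : ℕ → (Fin n → ℝ) → ℝ) (hφ : ∀ k, ContDiff ℝ ∞ (φ k)),
      Tendsto (fun k => boxLp a b (hφ k).continuous) atTop (𝓝 u) ∧
      (∀ i, Tendsto (fun k => boxLp a b ((hφ k).continuous_partialDeriv i)) atTop (𝓝 (G i))) ∧
      Tendsto (fun k => boundaryLp hab (hφ k).continuous) atTop (𝓝 τ) := by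
  obtain ⟨φ, hφ, h1, h2, h3⟩ := h
  exact ⟨φ, hφ, tendsto_toLp_of_eLpNorm _ h1, fun i => tendsto_toLp_of_eLpNorm _ (h2 i),
    tendsto_toLp_of_eLpNorm _ h3⟩

lemma isTrace_of_contDiff (hab : ∀ i, a i < b i) {φ : (Fin n → ℝ) → ℝ} (hφ : ContDiff ℝ ∞ φ) :
    IsTrace (boxLp a b hφ.continuous) (fun i => boxLp a b (hφ.continuous_partialDeriv i))
      (boundaryLp hab hφ.continuous) := by
  refine ⟨fun _ => φ, fun _ => hφ, ?_, fun i => ?_, ?_⟩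
  · simp only [boxLp, eLpNorm_sub_toLp]; exact tendsto_const_nhds
  · simp only [boxLp, eLpNorm_sub_toLp]; exact tendsto_const_nhds
  · simp only [boundaryLp, eLpNorm_sub_toLp]; exact tendsto_const_nhds

lemma isWeakGradient_of_contDiff (hab : ∀ i, a i < b i) {φ : (Fin n → ℝ) → ℝ}
    (hφ : ContDiff ℝ ∞ φ) : IsWeakGradient (boxLp a b hφ.continuous)
      (fun i => boxLp a b (hφ.continuous_partialDeriv i)) := by
  intro i ψ hψ _ hsupp
  have e1 : (∫ x in openBox a b, boxLp a b hφ.continuous x * partialDeriv i ψ x)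
      = ∫ x in openBox a b, φ x * partialDeriv i ψ x := by
    refine integral_congr_ae ?_
    filter_upwards [(memLp_openBox hφ.continuous 2).coeFn_toLp] with x hx
    rw [boxLp, hx]
  have e2 : (∫ x in openBox a b, boxLp a b (hφ.continuous_partialDeriv i) x * ψ x)
      = ∫ x in openBox a b, partialDeriv i φ x * ψ x := by
    refine integral_congr_ae ?_
    filter_upwards [(memLp_openBox (hφ.continuous_partialDeriv i) 2).coeFn_toLp] with x hx
    rw [boxLp, hx]
  rw [e1, e2, eq_neg_iff_add_eq_zero]
  have c1 : Continuous fun x => φ x * partialDeriv i ψ x :=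
    hφ.continuous.mul (hψ.continuous_partialDeriv i)
  have c2 : Continuous fun x => partialDeriv i φ x * ψ x :=
    (hφ.continuous_partialDeriv i).mul hψ.continuous
  rw [← integral_add (integrable_openBox c1) (integrable_openBox c2)]
  have hL : b i - a i ≠ 0 := (sub_pos.2 (hab i)).ne'
  apply mul_left_cancel₀ hL
  rw [mul_zero, ← integral_integral_update hab i (F := fun x => φ x * partialDeriv i ψ x
    + partialDeriv i φ x * ψ x) (c1.add c2)]
  refine integral_eq_zero_of_ae (Eventually.of_forall fun x => ?_)
  have hder : ∀ t ∈ Set.uIcc (a i) (b i),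
      HasDerivAt (fun t => φ (Function.update x i t) * ψ (Function.update x i t))
        (φ (Function.update x i t) * partialDeriv i ψ (Function.update x i t)
          + partialDeriv i φ (Function.update x i t) * ψ (Function.update x i t)) t := by
    intro t _
    have h1 := hasDerivAt_comp_update (hφ.differentiable (by simp)) x i t
    have h2 := hasDerivAt_comp_update (hψ.differentiable (by simp)) x i t
    have := h1.mul h2
    rw [add_comm] at this
    exact this
  have hline : Continuous fun t => Function.update x i t := continuous_const.update i continuous_id
  have hzero : ∀ c, c ∉ Set.Ioo (a i) (b i) → ψ (Function.update x i c) = 0 := by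
    intro c hc
    by_contra hne
    have := hsupp (subset_tsupport ψ hne) i (Set.mem_univ i)
    rw [Function.update_self] at this
    exact hc this
  show (∫ t in (a i)..(b i), _) = _
  rw [intervalIntegral.integral_eq_sub_of_hasDerivAt hder
    (((c1.comp hline).add (c2.comp hline)).intervalIntegrable _ _),
    hzero (a i) (by simp), hzero (b i) (by simp)]
  simp

variable {κ : Fin n → ℝ} {v : Fin n → ℝ → ℝ}

/-- The product function `x ↦ ∏ j, v j (x j)`. -/
def prodFun (v : Fin n → ℝ → ℝ) (x : Fin n → ℝ) : ℝ := ∏ j, v j (x j)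

lemma contDiff_prodFun (hv : ∀ j, ContDiff ℝ ∞ (v j)) : ContDiff ℝ ∞ (prodFun v) :=
  contDiff_prod fun j _ => (hv j).comp (contDiff_apply ℝ ℝ j)

lemma prodFun_update (v : Fin n → ℝ → ℝ) (x : Fin n → ℝ) (j : Fin n) (t : ℝ) :
    prodFun v (Function.update x j t) = v j t * ∏ i ∈ Finset.univ.erase j, v i (x i) := by
  rw [prodFun, ← Finset.mul_prod_erase _ _ (Finset.mem_univ j), Function.update_self]
  congr 1
  exact Finset.prod_congr rfl fun i hi => by rw [Function.update_of_ne (Finset.ne_of_mem_erase hi)]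

lemma partialDeriv_prodFun_update (hv : ∀ j, ContDiff ℝ ∞ (v j)) (x : Fin n → ℝ) (j : Fin n)
    (t : ℝ) : partialDeriv j (prodFun v) (Function.update x j t)
      = deriv (v j) t * ∏ i ∈ Finset.univ.erase j, v i (x i) := by
  have h1 := hasDerivAt_comp_update ((contDiff_prodFun hv).differentiable (by simp)) x j t
  simp only [prodFun_update] at h1
  exact h1.unique ((((hv j).differentiable (by simp) t).hasDerivAt).mul_const _)

lemma prod_weak_form (hab : ∀ i, a i < b i) (hv : ∀ j, RobinMode α (a j) (b j) (κ j) (v j))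
    {ψ : (Fin n → ℝ) → ℝ} (hψ : ContDiff ℝ ∞ ψ) :
    (∑ i, ∫ x in openBox a b, partialDeriv i (prodFun v) x * partialDeriv i ψ x)
      + α * (∫ x, prodFun v x * ψ x ∂surfaceMeasure a b)
      = (∑ i, κ i) * ∫ x in openBox a b, prodFun v x * ψ x := by
  have hW := contDiff_prodFun fun j => (hv j).smooth
  have c1 : Continuous fun x => prodFun v x * ψ x := hW.continuous.mul hψ.continuous
  rw [integral_surfaceMeasure hab c1, Finset.mul_sum, ← Finset.sum_add_distrib, Finset.sum_mul]
  refine Finset.sum_congr rfl fun i _ => ?_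
  have c2 : Continuous fun x => partialDeriv i (prodFun v) x * partialDeriv i ψ x :=
    (hW.continuous_partialDeriv i).mul (hψ.continuous_partialDeriv i)
  have hL : b i - a i ≠ 0 := (sub_pos.2 (hab i)).ne'
  apply mul_left_cancel₀ hL
  rw [← integral_fiber_energy hab i c2 c1, mul_left_comm, ← integral_integral_update hab i c1,
    ← integral_const_mul]
  congr 1
  ext x
  have key := (hv i).weak_form (contDiff_comp_update (k := 1) (hψ.of_le (by simp)) x i)
  simp only [(hasDerivAt_comp_update (hψ.differentiable (by simp)) x i _).deriv] at key
  simp only [prodFun_update, partialDeriv_prodFun_update fun j => (hv j).smooth]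
  set C := ∏ j ∈ Finset.univ.erase i, v j (x j)
  have e1 : ∀ p q : ℝ → ℝ, (∫ t in (a i)..(b i), p t * C * q t)
      = C * ∫ t in (a i)..(b i), p t * q t := by
    intro p q
    rw [← intervalIntegral.integral_const_mul]
    congr 1; ext t; ring
  rw [e1, e1]
  linear_combination C * key

lemma isRobinSolution_prodFun (hab : ∀ i, a i < b i)
    (hv : ∀ j, RobinMode α (a j) (b j) (κ j) (v j)) :
    IsRobinSolution α (∑ i, κ i)
      (boxLp a b (contDiff_prodFun fun j => (hv j).smooth).continuous) := by
  have hW := contDiff_prodFun fun j => (hv j).smooth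
  refine ⟨_, _, isWeakGradient_of_contDiff hab hW, isTrace_of_contDiff hab hW, ?_⟩
  intro f H η _ hf
  obtain ⟨φ, hφ, h1, h2, h3⟩ := hf.exists_tendsto hab
  refine tendsto_nhds_unique (Tendsto.add (tendsto_finsetSum _ fun i _ =>
    tendsto_const_nhds.inner (h2 i)) ((tendsto_const_nhds.inner h3).const_mul α)) ?_
  refine ((tendsto_const_nhds.inner h1).const_mul _).congr fun k => ?_
  simp only [inner_boxLp, inner_boundaryLp]
  exact (prod_weak_form hab hv (hφ k)).symm

lemma boxLp_prodFun_ne_zero (hc : Continuous (prodFun v))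
    (hab : ∀ i, a i < b i) (hne : ∀ j, (∫ t in (a j)..(b j), v j t ^ 2) ≠ 0) :
    boxLp a b hc ≠ 0 := by
  intro h0
  have h1 := inner_boxLp (a := a) (b := b) hc hc
  rw [h0, inner_zero_left, restrict_openBox] at h1
  have h2 : ∀ x, prodFun v x * prodFun v x = ∏ j, (v j (x j)) ^ 2 := by
    intro x; rw [Finset.prod_pow, sq, prodFun]
  simp only [h2] at h1
  rw [integral_fintype_prod_eq_prod (f := fun j t => v j t ^ 2)] at h1
  refine Finset.prod_ne_zero_iff.2 (fun j _ => ?_) h1.symm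
  have := hne j
  rwa [intervalIntegral.integral_of_le (hab j).le, integral_Ioc_eq_integral_Ioo] at this

/-- Eigenfunctions with distinct eigenvalues are orthogonal. -/
lemma IsRobinSolution.inner_eq_zero {μ ν : ℝ} {u w : L2Box a b} (hu : IsRobinSolution α μ u)
    (hw : IsRobinSolution α ν w) (hne : μ ≠ ν) : inner ℝ u w = 0 := by
  obtain ⟨G, τ, hG, hτ, h1⟩ := hu
  obtain ⟨H, η, hH, hη, h2⟩ := hw
  have e1 := h1 w H η hH hη
  have e2 := h2 u G τ hG hτ
  rw [real_inner_comm τ η, real_inner_comm u w,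
    Finset.sum_congr rfl fun i _ => real_inner_comm (G i) (H i)] at e2
  have : (μ - ν) * inner ℝ u w = 0 := by linear_combination e2 - e1
  exact (mul_eq_zero.1 this).resolve_left (sub_ne_zero.2 hne)

variable {μ ν m : Fin n → ℝ} {u w : Fin n → ℝ → ℝ}

/-- The spectral gap inequality on a box, in `H¹(B)`. -/
lemma IsTrace.gap_le (hp : ∀ j, RobinPair α (a j) (b j) (μ j) (ν j) (m j) (u j) (w j)) {γ : ℝ}
    (hγ : ∀ j, γ ≤ ν j - μ j) (hγ0 : 0 ≤ γ) {f : L2Box a b} {G : Fin n → L2Box a b}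
    {τ : L2Boundary a b} (h : IsTrace f G τ) (hc : Continuous (prodFun u)) :
    γ * (inner ℝ f f - (inner ℝ f (boxLp a b hc)) ^ 2
        / inner ℝ (boxLp a b hc) (boxLp a b hc))
      ≤ (∑ i, inner ℝ (G i) (G i)) + α * inner ℝ τ τ - (∑ i, μ i) * inner ℝ f f := by
  have hab : ∀ i, a i < b i := fun i => (hp i).lt_mid.trans (hp i).mid_lt
  obtain ⟨φ, hφ, h1, h2, h3⟩ := h.exists_tendsto hab
  refine le_of_tendsto_of_tendsto' (Tendsto.const_mul γ ((h1.inner h1).sub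
    (((h1.inner tendsto_const_nhds).pow 2).div_const _)))
    (((tendsto_finsetSum _ fun i _ => (h2 i).inner (h2 i)).add
      ((h3.inner h3).const_mul α)).sub ((h1.inner h1).const_mul _)) fun k => ?_
  simp only [inner_boxLp, inner_boundaryLp, ← sq]
  exact box_gap_le hp hγ hγ0 ((hφ k).of_le (by simp))

lemma one_le_rank_of_mem {V : Type*} [AddCommGroup V] [Module ℝ V] {S : Submodule ℝ V} {x : V}
    (hx : x ∈ S) (h0 : x ≠ 0) : ((1 : ℕ) : Cardinal) ≤ Module.rank ℝ S := by
  have : Nontrivial S := ⟨⟨x, hx⟩, 0, fun h => h0 (congrArg Subtype.val h)⟩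
  rw [Nat.cast_one, Cardinal.one_le_iff_pos]
  exact rank_pos

lemma two_le_rank_of_inner_eq_zero {V : Type*} [NormedAddCommGroup V] [InnerProductSpace ℝ V]
    {S : Submodule ℝ V} {x y : V} (hx : x ∈ S) (hy : y ∈ S) (hx0 : x ≠ 0) (hy0 : y ≠ 0)
    (hxy : inner ℝ x y = 0) : ((2 : ℕ) : Cardinal) ≤ Module.rank ℝ S := by
  let v : Fin 2 → S := ![⟨x, hx⟩, ⟨y, hy⟩]
  have hv : LinearIndependent ℝ v := by
    refine linearIndependent_of_ne_zero_of_inner_eq_zero (𝕜 := ℝ) (fun i => ?_) fun i j hij => ?_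
    · fin_cases i
      · exact fun h => hx0 (congrArg Subtype.val h)
      · exact fun h => hy0 (congrArg Subtype.val h)
    · fin_cases i <;> fin_cases j
      · exact absurd rfl hij
      · exact hxy
      · exact (real_inner_comm x y).trans hxy
      · exact absurd rfl hij
  simpa using hv.cardinal_lift_le_rank

lemma IsRobinSolution.eq_zero_or_mem_span
    (hp : ∀ j, RobinPair α (a j) (b j) (μ j) (ν j) (m j) (u j) (w j)) {γ : ℝ}
    (hγ : ∀ j, γ ≤ ν j - μ j) (hγ0 : 0 < γ)
    {κ : ℝ} {f : L2Box a b} (hf : IsRobinSolution α κ f)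
    (hκ : κ < (∑ i, μ i) + γ) (hc : Continuous (prodFun u)) :
    f = 0 ∨ κ = ∑ i, μ i ∧ f ∈ Submodule.span ℝ {boxLp a b hc} := by
  have hab : ∀ i, a i < b i := fun i => (hp i).lt_mid.trans (hp i).mid_lt
  have hU := isRobinSolution_prodFun hab fun j => (hp j).fst
  set U := boxLp a b hc with hUdef
  have hU0 : U ≠ 0 := boxLp_prodFun_ne_zero hc hab
    fun j => (hp j).integral_sq_pos.ne'
  have hUU : 0 < inner ℝ U U := real_inner_self_pos.2 hU0
  have horth := fun h => hf.inner_eq_zero hU h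
  obtain ⟨G, τ, hG, hτ, h⟩ := hf
  have e := h f G τ hG hτ
  have hgap := hτ.gap_le hp hγ hγ0.le hc
  rw [e, ← sub_mul] at hgap
  by_cases hκμ : κ = ∑ i, μ i
  · refine Or.inr ⟨hκμ, ?_⟩
    rw [hκμ, sub_self, zero_mul] at hgap
    set c := inner ℝ f U / inner ℝ U U with hcdef
    have hz : inner ℝ (f - c • U) (f - c • U) ≤ 0 := by
      have : inner ℝ (f - c • U) (f - c • U)
          = inner ℝ f f - (inner ℝ f U) ^ 2 / inner ℝ U U := by
        rw [inner_sub_left, inner_sub_right, inner_sub_right, inner_smul_left, inner_smul_right,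
          inner_smul_left, inner_smul_right, real_inner_comm f U, hcdef]
        simp only [conj_trivial]
        field_simp
        ring
      rw [this]
      nlinarith
    have hz0 := real_inner_self_nonpos.1 hz
    rw [sub_eq_zero.1 hz0]
    exact Submodule.smul_mem _ _ (Submodule.mem_span_singleton_self _)
  · left
    have h0 : inner ℝ f U = 0 := horth hκμ
    rw [h0] at hgap
    simp only [ne_eq, OfNat.ofNat_ne_zero, not_false_eq_true, zero_pow, zero_div, sub_zero] at hgap
    have hff : (0 : ℝ) ≤ inner ℝ f f := real_inner_self_nonneg
    apply real_inner_self_nonpos.1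
    by_contra hpos
    push Not at hpos
    have := le_of_mul_le_mul_right hgap hpos
    linarith

lemma robinEigenvalue_one
    (hp : ∀ j, RobinPair α (a j) (b j) (μ j) (ν j) (m j) (u j) (w j)) {γ : ℝ}
    (hγ : ∀ j, γ ≤ ν j - μ j) (hγ0 : 0 < γ) :
    robinEigenvalue a b α 1 = ∑ i, μ i := by
  have hab : ∀ i, a i < b i := fun i => (hp i).lt_mid.trans (hp i).mid_lt
  have hc : Continuous (prodFun u) := (contDiff_prodFun fun j => (hp j).fst.smooth).continuous
  have hU := isRobinSolution_prodFun hab fun j => (hp j).fst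
  have hU0 : boxLp a b hc ≠ 0 := boxLp_prodFun_ne_zero hc hab
    fun j => (hp j).integral_sq_pos.ne'
  have : {Λ : ℝ | ((1 : ℕ) : Cardinal) ≤ Module.rank ℝ (robinSpan a b α Λ)}
      = Set.Ici (∑ i, μ i) := by
    ext Λ
    simp only [Set.mem_ofPred_eq, Set.mem_Ici]
    constructor
    · intro h
      by_contra! hlt
      have : robinSpan a b α Λ = ⊥ := by
        rw [robinSpan, Submodule.span_eq_bot]
        rintro f ⟨κ, hκ, hf⟩
        rcases hf.eq_zero_or_mem_span hp hγ hγ0 (by linarith) hc with h | ⟨h, -⟩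
        · exact h
        · linarith
      rw [this, rank_bot] at h
      simp at h
    · intro h
      exact one_le_rank_of_mem (Submodule.subset_span ⟨_, h, hU⟩) hU0
  rw [robinEigenvalue, this, csInf_Ici]

lemma robinEigenvalue_two
    (hp : ∀ j, RobinPair α (a j) (b j) (μ j) (ν j) (m j) (u j) (w j)) {γ : ℝ}
    (hγ : ∀ j, γ ≤ ν j - μ j) (hγ0 : 0 < γ)
    {j : Fin n} (hj : γ = ν j - μ j) :
    robinEigenvalue a b α 2 = (∑ i, μ i) + γ := by
  have hab : ∀ i, a i < b i := fun i => (hp i).lt_mid.trans (hp i).mid_lt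
  have hc : Continuous (prodFun u) := (contDiff_prodFun fun j => (hp j).fst.smooth).continuous
  have hU := isRobinSolution_prodFun hab fun j => (hp j).fst
  have hU0 : boxLp a b hc ≠ 0 := boxLp_prodFun_ne_zero hc hab
    fun j => (hp j).integral_sq_pos.ne'
  have hmode : ∀ i, RobinMode α (a i) (b i) (Function.update μ j (ν j) i)
      (Function.update u j (w j) i) := by
    intro i
    by_cases h : i = j
    · subst h; simpa using (hp i).snd
    · simpa [h] using (hp i).fst
  have hW := isRobinSolution_prodFun hab hmode
  have hsum : ∑ i, Function.update μ j (ν j) i = (∑ i, μ i) + γ := by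
    rw [Finset.sum_update_of_mem (Finset.mem_univ j), hj,
      ← Finset.add_sum_erase _ _ (Finset.mem_univ j), Finset.sdiff_singleton_eq_erase]
    ring
  rw [hsum] at hW
  have hW0 := boxLp_prodFun_ne_zero
    (contDiff_prodFun fun i => (hmode i).smooth).continuous hab (by
      intro i
      by_cases h : i = j
      · subst h
        rw [Function.update_self]
        refine (intervalIntegral.integral_pos (hab i) ((hp i).snd.continuous.pow 2).continuousOn
          (fun x _ => sq_nonneg _) ⟨b i, ⟨(hab i).le, le_rfl⟩, ?_⟩).ne'
        have := (hp i).snd_ne (b i) ⟨(hab i).le, le_rfl⟩ (hp i).mid_lt.ne'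
        exact sq_pos_of_ne_zero this
      · rw [Function.update_of_ne h]
        exact (hp i).integral_sq_pos.ne')
  have : {Λ : ℝ | ((2 : ℕ) : Cardinal) ≤ Module.rank ℝ (robinSpan a b α Λ)}
      = Set.Ici ((∑ i, μ i) + γ) := by
    ext Λ
    simp only [Set.mem_ofPred_eq, Set.mem_Ici]
    constructor
    · intro h
      by_contra! hlt
      have hle : robinSpan a b α Λ ≤ Submodule.span ℝ {boxLp a b hc} := by
        rw [robinSpan, Submodule.span_le]
        rintro f ⟨κ, hκ, hf⟩
        rcases hf.eq_zero_or_mem_span hp hγ hγ0 (by linarith) hc with h | ⟨-, h⟩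
        · rw [h]; exact Submodule.zero_mem _
        · exact h
      have h1 := h.trans ((Submodule.rank_mono hle).trans (rank_span_le _))
      rw [Cardinal.mk_singleton] at h1
      norm_cast at h1
    · intro h
      exact two_le_rank_of_inner_eq_zero
        (Submodule.subset_span ⟨_, (by linarith : (∑ i, μ i) ≤ Λ), hU⟩)
        (Submodule.subset_span ⟨_, h, hW⟩) hU0 hW0
        (hU.inner_eq_zero hW (by linarith))
  rw [robinEigenvalue, this, csInf_Ici]

end Box

section Modes

variable {α a b r : ℝ}

lemma robinMode_of_hasDerivAt {μ : ℝ} {u u' : ℝ → ℝ} (hs : ContDiff ℝ ∞ u)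
    (h1 : ∀ x, HasDerivAt u (u' x) x) (h2 : ∀ x, HasDerivAt u' (-μ * u x) x)
    (ha : u' a = α * u a) (hb : u' b = -α * u b) : RobinMode α a b μ u := by
  have : deriv u = u' := funext fun x => (h1 x).deriv
  exact ⟨hs, fun x => this ▸ h2 x, this ▸ ha, this ▸ hb⟩

/-- `w` is a Robin mode that vanishes, to first order, at the midpoint of the interval and at no
other point. -/
def IsOddMode (α a b ν : ℝ) (w : ℝ → ℝ) : Prop :=
  RobinMode α a b ν w ∧ w ((a + b) / 2) = 0 ∧ deriv w ((a + b) / 2) ≠ 0 ∧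
    ∀ x ∈ Set.Icc a b, x ≠ (a + b) / 2 → w x ≠ 0

lemma hasDerivAt_affine (r m x : ℝ) : HasDerivAt (fun x => r * (x - m)) r x := by
  simpa using ((hasDerivAt_id x).sub_const m).const_mul r

lemma robinMode_cos (h : r * Real.sin (r * ((b - a) / 2)) = α * Real.cos (r * ((b - a) / 2))) :
    RobinMode α a b (r ^ 2) fun x => Real.cos (r * (x - (a + b) / 2)) := by
  have ea : r * (a - (a + b) / 2) = -(r * ((b - a) / 2)) := by ring
  have eb : r * (b - (a + b) / 2) = r * ((b - a) / 2) := by ring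
  refine robinMode_of_hasDerivAt (u' := fun x => -Real.sin (r * (x - (a + b) / 2)) * r)
    (by fun_prop) (fun x => (hasDerivAt_affine r _ x).cos) (fun x => ?_) ?_ ?_
  · exact ((hasDerivAt_affine r _ x).sin.neg.mul_const r).congr_deriv (by ring)
  · simp only [ea, Real.sin_neg, Real.cos_neg]; linarith
  · simp only [eb]; linarith

lemma robinMode_cosh
    (h : r * Real.sinh (r * ((b - a) / 2)) = -α * Real.cosh (r * ((b - a) / 2))) :
    RobinMode α a b (-r ^ 2) fun x => Real.cosh (r * (x - (a + b) / 2)) := by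
  have ea : r * (a - (a + b) / 2) = -(r * ((b - a) / 2)) := by ring
  have eb : r * (b - (a + b) / 2) = r * ((b - a) / 2) := by ring
  refine robinMode_of_hasDerivAt (u' := fun x => Real.sinh (r * (x - (a + b) / 2)) * r)
    (Real.contDiff_cosh.comp (by fun_prop)) (fun x => (hasDerivAt_affine r _ x).cosh)
    (fun x => ?_) ?_ ?_
  · exact ((hasDerivAt_affine r _ x).sinh.mul_const r).congr_deriv (by ring)
  · simp only [ea, Real.sinh_neg, Real.cosh_neg]; linarith
  · simp only [eb]; linarith

lemma isOddMode_sin (hr : 0 < r) (hpi : r * ((b - a) / 2) < Real.pi)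
    (h : r * Real.cos (r * ((b - a) / 2)) = -α * Real.sin (r * ((b - a) / 2))) :
    IsOddMode α a b (r ^ 2) fun x => Real.sin (r * (x - (a + b) / 2)) := by
  have ea : r * (a - (a + b) / 2) = -(r * ((b - a) / 2)) := by ring
  have eb : r * (b - (a + b) / 2) = r * ((b - a) / 2) := by ring
  have hd : ∀ x, HasDerivAt (fun x => Real.sin (r * (x - (a + b) / 2)))
    (Real.cos (r * (x - (a + b) / 2)) * r) x := fun x => (hasDerivAt_affine r _ x).sin
  refine ⟨robinMode_of_hasDerivAt (u' := fun x => Real.cos (r * (x - (a + b) / 2)) * r)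
    (by fun_prop) hd (fun x => ?_) ?_ ?_, by simp, ?_, ?_⟩
  · exact ((hasDerivAt_affine r _ x).cos.mul_const r).congr_deriv (by ring)
  · simp only [ea, Real.sin_neg, Real.cos_neg]; linarith
  · simp only [eb]; linarith
  · rw [(hd _).deriv]; simpa using hr.ne'
  · rintro x ⟨hxa, hxb⟩ hxm h0
    have h1 : r * (x - (a + b) / 2) ≤ r * ((b - a) / 2) :=
      mul_le_mul_of_nonneg_left (by linarith) hr.le
    have h2 : -(r * ((b - a) / 2)) ≤ r * (x - (a + b) / 2) := by
      rw [← ea]; exact mul_le_mul_of_nonneg_left (by linarith) hr.le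
    have := (Real.sin_eq_zero_iff_of_lt_of_lt (by linarith) (by linarith)).1 h0
    exact hxm (sub_eq_zero.1 ((mul_eq_zero.1 this).resolve_left hr.ne'))

lemma isOddMode_sinh (hr : 0 < r)
    (h : r * Real.cosh (r * ((b - a) / 2)) = -α * Real.sinh (r * ((b - a) / 2))) :
    IsOddMode α a b (-r ^ 2) fun x => Real.sinh (r * (x - (a + b) / 2)) := by
  have ea : r * (a - (a + b) / 2) = -(r * ((b - a) / 2)) := by ring
  have eb : r * (b - (a + b) / 2) = r * ((b - a) / 2) := by ring
  have hd : ∀ x, HasDerivAt (fun x => Real.sinh (r * (x - (a + b) / 2)))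
    (Real.cosh (r * (x - (a + b) / 2)) * r) x := fun x => (hasDerivAt_affine r _ x).sinh
  refine ⟨robinMode_of_hasDerivAt (u' := fun x => Real.cosh (r * (x - (a + b) / 2)) * r)
    (Real.contDiff_sinh.comp (by fun_prop)) hd (fun x => ?_) ?_ ?_, by simp, ?_, ?_⟩
  · exact ((hasDerivAt_affine r _ x).cosh.mul_const r).congr_deriv (by ring)
  · simp only [ea, Real.sinh_neg, Real.cosh_neg]; linarith
  · simp only [eb]; linarith
  · rw [(hd _).deriv]; simpa using hr.ne'
  · rintro x - hxm h0
    exact hxm (sub_eq_zero.1 ((mul_eq_zero.1 (Real.sinh_eq_zero.1 h0)).resolve_left hr.ne'))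

lemma isOddMode_linear (h : -α * ((b - a) / 2) = 1) :
    IsOddMode α a b 0 fun x => x - (a + b) / 2 := by
  have hd : ∀ x, HasDerivAt (fun x => x - (a + b) / 2) 1 x := fun x =>
    (hasDerivAt_id x).sub_const _
  refine ⟨robinMode_of_hasDerivAt (u' := fun _ => 1) (by fun_prop) hd (fun x => ?_) ?_ ?_,
    by simp, ?_, ?_⟩
  · exact (hasDerivAt_const x (1 : ℝ)).congr_deriv (by ring)
  · linarith
  · linarith
  · rw [(hd _).deriv]; exact one_ne_zero
  · rintro x - hxm
    exact sub_ne_zero.2 hxm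

lemma IsOddMode.robinPair {μ ν : ℝ} {u w : ℝ → ℝ} (hab : a < b) (hw : IsOddMode α a b ν w)
    (hu : RobinMode α a b μ u) (hm : u ((a + b) / 2) ≠ 0) (h : μ < ν) :
    RobinPair α a b μ ν ((a + b) / 2) u w :=
  ⟨hu, hw.1, by linarith, by linarith, hm, hw.2.1, hw.2.2.1, hw.2.2.2, h⟩

end Modes

/-- A function whose derivative with respect to an increasing function is increasing lies above
its tangent lines. -/
lemma le_of_hasDerivAt_ratio {I : Set ℝ} (hI : I.OrdConnected) {f g g' E : ℝ → ℝ}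
    (hf : ∀ x ∈ I, HasDerivAt f (-E x * g' x) x) (hg : ∀ x ∈ I, HasDerivAt g (g' x) x)
    (hg' : ∀ x ∈ I, 0 < g' x) (hE : AntitoneOn E I) {x y : ℝ} (hx : x ∈ I) (hy : y ∈ I) :
    f x - E x * (g y - g x) ≤ f y := by
  have key : ∀ p ∈ I, ∀ q ∈ I, p < q → ∃ c ∈ I, p ≤ c ∧ c ≤ q ∧ g p < g q ∧
      f q - f p = -E c * (g q - g p) := by
    intro p hp q hq hpq
    have hsub : Set.Icc p q ⊆ I := hI.out hp hq
    have hsub' : Set.Ioo p q ⊆ I := Set.Ioo_subset_Icc_self.trans hsub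
    obtain ⟨c, hc, h⟩ := exists_ratio_hasDerivAt_eq_ratio_slope f (fun x => -E x * g' x) hpq
      (fun x hx => (hf x (hsub hx)).continuousAt.continuousWithinAt) (fun x hx => hf x (hsub' hx))
      g g' (fun x hx => (hg x (hsub hx)).continuousAt.continuousWithinAt)
      (fun x hx => hg x (hsub' hx))
    refine ⟨c, hsub' hc, hc.1.le, hc.2.le, ?_, ?_⟩
    · obtain ⟨d, hd, h⟩ := exists_hasDerivAt_eq_slope g g' hpq
        (fun x hx => (hg x (hsub hx)).continuousAt.continuousWithinAt)
        (fun x hx => hg x (hsub' hx))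
      have := hg' d (hsub' hd)
      rw [h] at this
      exact sub_pos.1 ((div_pos_iff_of_pos_right (sub_pos.2 hpq)).1 this)
    · have := hg' c (hsub' hc)
      apply mul_right_cancel₀ this.ne'
      linear_combination -h
  rcases lt_trichotomy x y with h | rfl | h
  · obtain ⟨c, hc, h1, -, h2, h3⟩ := key x hx y hy h
    have := hE hx hc h1
    nlinarith
  · simp
  · obtain ⟨c, hc, -, h1, h2, h3⟩ := key y hy x hx h
    have := hE hc hx h1
    nlinarith

/-- What the isoperimetric argument uses about the first two Robin eigenvalues `μ l`, `ν l` of an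
interval of half-length `l`. -/
structure RobinSpectrum (α : ℝ) (μ ν : ℝ → ℝ) : Prop where
  pair : ∀ a b, a < b → ∃ u w, RobinPair α a b (μ ((b - a) / 2)) (ν ((b - a) / 2)) ((a + b) / 2) u w
  gap_anti : ∀ l₁ l₂, 0 < l₁ → l₁ < l₂ → ν l₂ - μ l₂ < ν l₁ - μ l₁
  sign : (∀ l, 0 < l → 0 < μ l) ∨ ∀ l, 0 < l → μ l < 0
  log_convex : ∀ l, 0 < l → ∃ K, ∀ l', 0 < l' → |μ l| - K * (Real.log l' - Real.log l) ≤ |μ l'|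

section Trig

open Real

lemma hasDerivAt_mul_tan_log {y : ℝ} (h0 : 0 < y) (h1 : y < π / 2) :
    HasDerivAt (fun y => log (y * tan y)) (1 / y + 1 / (sin y * cos y)) y := by
  have hs := sin_pos_of_pos_of_lt_pi h0 (by linarith [pi_pos])
  have hc := cos_pos_of_mem_Ioo ⟨by linarith [pi_pos], h1⟩
  have ht : 0 < tan y := by rw [tan_eq_sin_div_cos]; positivity
  refine (((hasDerivAt_id y).mul (hasDerivAt_tan hc.ne')).log (mul_pos h0 ht).ne').congr_deriv ?_
  simp only [Pi.mul_apply, id, tan_eq_sin_div_cos]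
  field_simp

lemma monotoneOn_tan_div : MonotoneOn (fun y => tan y / y) (Set.Ioo 0 (π / 2)) := by
  have hder : ∀ y ∈ Set.Ioo 0 (π / 2), HasDerivAt (fun y => tan y / y)
      ((1 / cos y ^ 2 * y - tan y * 1) / y ^ 2) y := by
    intro y hy
    have hc := cos_pos_of_mem_Ioo ⟨by linarith [pi_pos, hy.1], hy.2⟩
    exact (hasDerivAt_tan hc.ne').div (hasDerivAt_id y) hy.1.ne'
  refine monotoneOn_of_deriv_nonneg (convex_Ioo _ _)
    (fun y hy => (hder y hy).continuousAt.continuousWithinAt)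
    (fun y hy => ((hder y (interior_subset hy)).differentiableAt).differentiableWithinAt) ?_
  intro y hy
  rw [interior_Ioo] at hy
  rw [(hder y hy).deriv]
  have hc := cos_pos_of_mem_Ioo ⟨by linarith [pi_pos, hy.1], hy.2⟩
  have hs := sin_lt hy.1
  have hs0 := sin_pos_of_pos_of_lt_pi hy.1 (by linarith [pi_pos, hy.2])
  have : 0 ≤ 1 / cos y ^ 2 * y - tan y * 1 := by
    rw [tan_eq_sin_div_cos, show 1 / cos y ^ 2 * y - sin y / cos y * 1
      = (y - sin y * cos y) / cos y ^ 2 by field_simp]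
    have := cos_le_one y
    exact div_nonneg (by nlinarith) (by positivity)
  positivity

/-- Tangent line inequality for `cot² y` as a function of `log (y tan y)`. -/
lemma exists_inv_tan_sq_ge {x : ℝ} (hx : x ∈ Set.Ioo 0 (π / 2)) : ∃ K, ∀ y ∈ Set.Ioo 0 (π / 2),
    (tan x ^ 2)⁻¹ - K * (log (y * tan y) - log (x * tan x)) ≤ (tan y ^ 2)⁻¹ := by
  refine ⟨_, fun y hy => le_of_hasDerivAt_ratio (I := Set.Ioo 0 (π / 2))
    (f := fun y => (tan y ^ 2)⁻¹) (g := fun y => log (y * tan y))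
    (E := fun y => 2 / (tan y ^ 2 + sin y ^ 2 * (tan y / y)))
    (g' := fun y => 1 / y + 1 / (sin y * cos y))
    Set.ordConnected_Ioo (fun y hy => ?_)
    (fun y hy => hasDerivAt_mul_tan_log hy.1 hy.2) (fun y hy => ?_) ?_ hx hy⟩
  · have hc := cos_pos_of_mem_Ioo ⟨by linarith [pi_pos, hy.1], hy.2⟩
    have hs := sin_pos_of_pos_of_lt_pi hy.1 (by linarith [pi_pos, hy.2])
    have hy0 := hy.1
    have ht : 0 < tan y := by rw [tan_eq_sin_div_cos]; positivity
    refine (((hasDerivAt_tan hc.ne').pow 2).inv (by simp; positivity)).congr_deriv ?_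
    simp only [Pi.pow_apply, tan_eq_sin_div_cos, Nat.cast_ofNat, Nat.add_one_sub_one, pow_one]
    field_simp
    ring
  · have hc := cos_pos_of_mem_Ioo ⟨by linarith [pi_pos, hy.1], hy.2⟩
    have hs := sin_pos_of_pos_of_lt_pi hy.1 (by linarith [pi_pos, hy.2])
    have hy0 := hy.1
    positivity
  · intro p hp q hq hpq
    have hs := sin_pos_of_pos_of_lt_pi hp.1 (by linarith [pi_pos, hp.2])
    have htp := tan_pos_of_pos_of_lt_pi_div_two hp.1 hp.2
    have hp0 := hp.1
    have h1 := monotoneOn_tan_div hp hq hpq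
    have h2 : tan p ≤ tan q := strictMonoOn_tan.monotoneOn
      ⟨by linarith [pi_pos], hp.2⟩ ⟨by linarith [pi_pos, hq.1], hq.2⟩ hpq
    have h3 : sin p ≤ sin q := strictMonoOn_sin.monotoneOn
      ⟨by linarith [pi_pos], hp.2.le⟩ ⟨by linarith [pi_pos, hq.1], hq.2.le⟩ hpq
    simp only at h1 ⊢
    gcongr

lemma exists_add_mul_tan_eq {k s : ℝ} (hk : 0 ≤ k) (hs : 0 < s) :
    ∃ y ∈ Set.Ioo 0 (π / 2), (k + y) * tan y = s := by
  have hcont : ContinuousOn (fun y => (k + y) * sin y - s * cos y) (Set.Icc 0 (π / 2)) := by fun_prop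
  have hmem : (0 : ℝ) ∈ Set.Ioo ((k + 0) * sin 0 - s * cos 0)
      ((k + π / 2) * sin (π / 2) - s * cos (π / 2)) := by
    simp only [sin_zero, cos_zero, sin_pi_div_two, cos_pi_div_two]
    constructor <;> linarith [pi_pos]
  obtain ⟨y, hy, h⟩ := intermediate_value_Ioo (by positivity) hcont hmem
  refine ⟨y, hy, ?_⟩
  have hc := cos_pos_of_mem_Ioo ⟨by linarith [pi_pos, hy.1], hy.2⟩
  rw [tan_eq_sin_div_cos]
  field_simp
  simp only at h
  linarith

lemma lt_of_add_mul_tan_lt {k y₁ y₂ : ℝ} (hk : 0 ≤ k) (h₁ : y₁ ∈ Set.Ioo 0 (π / 2))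
    (h₂ : y₂ ∈ Set.Ioo 0 (π / 2)) (h : (k + y₁) * tan y₁ < (k + y₂) * tan y₂) : y₁ < y₂ := by
  by_contra! hle
  have h2 : tan y₂ ≤ tan y₁ := strictMonoOn_tan.monotoneOn
      ⟨by linarith [pi_pos, h₂.1], h₂.2⟩ ⟨by linarith [pi_pos, h₁.1], h₁.2⟩ hle
  have := tan_pos_of_pos_of_lt_pi_div_two h₂.1 h₂.2
  have := h₁.1
  have : (k + y₂) * tan y₂ ≤ (k + y₁) * tan y₁ := by gcongr
  linarith

theorem exists_robinSpectrum_of_pos {α : ℝ} (hα : 0 < α) : ∃ μ ν, RobinSpectrum α μ ν := by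
  have hpi := pi_pos
  have hy : ∀ l : ℝ, ∃ y, 0 < l → y ∈ Set.Ioo 0 (π / 2) ∧ y * tan y = α * l := by
    intro l
    by_cases hl : 0 < l
    · obtain ⟨y, h1, h2⟩ := exists_add_mul_tan_eq (k := 0) le_rfl (mul_pos hα hl)
      exact ⟨y, fun _ => ⟨h1, by simpa using h2⟩⟩
    · exact ⟨0, fun h => absurd h hl⟩
  have hz : ∀ l : ℝ, ∃ y, 0 < l → y ∈ Set.Ioo 0 (π / 2) ∧ (π / 2 + y) * tan y = α * l := by
    intro l
    by_cases hl : 0 < l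
    · obtain ⟨y, h1, h2⟩ := exists_add_mul_tan_eq (k := π / 2) (by positivity) (mul_pos hα hl)
      exact ⟨y, fun _ => ⟨h1, h2⟩⟩
    · exact ⟨0, fun h => absurd h hl⟩
  choose y hy using hy
  choose z hz using hz
  have hμ : ∀ l, 0 < l → (y l / l) ^ 2 = α ^ 2 * (tan (y l) ^ 2)⁻¹ := by
    intro l hl
    obtain ⟨⟨h1, h2⟩, h3⟩ := hy l hl
    have ht := tan_pos_of_pos_of_lt_pi_div_two h1 h2
    have : y l = α * l / tan (y l) := by rw [← h3]; field_simp
    rw [show y l / l = α / tan (y l) by rw [div_eq_div_iff hl.ne' ht.ne', h3]]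
    field_simp
  refine ⟨fun l => (y l / l) ^ 2, fun l => ((π / 2 + z l) / l) ^ 2, ?_, ?_, ?_, ?_⟩
  · intro a b hab
    have hl : 0 < (b - a) / 2 := by linarith
    obtain ⟨⟨h1, h2⟩, h3⟩ := hy _ hl
    obtain ⟨⟨h1', h2'⟩, h3'⟩ := hz _ hl
    set l := (b - a) / 2 with hldef
    have hc := cos_pos_of_mem_Ioo ⟨by linarith, h2⟩
    have hc' := cos_pos_of_mem_Ioo ⟨by linarith, h2'⟩
    rw [tan_eq_sin_div_cos] at h3 h3'
    have e1 : y l / l * ((b - a) / 2) = y l := by rw [← hldef]; field_simp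
    have e2 : (π / 2 + z l) / l * ((b - a) / 2) = π / 2 + z l := by rw [← hldef]; field_simp
    refine ⟨_, _, (isOddMode_sin (r := (π / 2 + z l) / l) (by positivity) ?_ ?_).robinPair hab
      (robinMode_cos (r := y l / l) ?_) (by simp) ?_⟩
    · rw [e2]; linarith
    · rw [e2, add_comm (π / 2), sin_add_pi_div_two, cos_add_pi_div_two, add_comm (z l)]
      field_simp at h3' ⊢
      linarith
    · rw [e1]
      field_simp at h3 ⊢
      linarith
    · have : y l / l < (π / 2 + z l) / l := by gcongr; linarith
      gcongr
  · intro l₁ l₂ hl₁ hlt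
    have hl₂ := hl₁.trans hlt
    have hlt' : α * l₁ < α * l₂ := mul_lt_mul_of_pos_left hlt hα
    have first : (y l₁ / l₁) ^ 2 - (π / 2 / l₁) ^ 2 < (y l₂ / l₂) ^ 2 - (π / 2 / l₂) ^ 2 := by
      obtain ⟨h1, h3⟩ := hy _ hl₁
      obtain ⟨h1', h3'⟩ := hy _ hl₂
      have hlt : y l₁ < y l₂ := lt_of_add_mul_tan_lt (k := 0) le_rfl h1 h1' (by simpa [h3, h3'])
      have key : ∀ l, 0 < l → (y l / l) ^ 2 - (π / 2 / l) ^ 2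
          = -(((π / 2) ^ 2 - y l ^ 2) / l ^ 2) := fun l hl => by ring
      rw [key _ hl₁, key _ hl₂, neg_lt_neg_iff]
      have ha := h1.1
      have hb := h1'.2
      have n1 : (π / 2) ^ 2 - y l₂ ^ 2 < (π / 2) ^ 2 - y l₁ ^ 2 := by nlinarith
      have n2 : 0 < (π / 2) ^ 2 - y l₂ ^ 2 := by nlinarith
      exact div_lt_div₀ n1 (by gcongr) (n2.trans n1).le (by positivity)
    have second : ((π / 2 + z l₂) / l₂) ^ 2 - (π / 2 / l₂) ^ 2
        < ((π / 2 + z l₁) / l₁) ^ 2 - (π / 2 / l₁) ^ 2 := by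
      obtain ⟨h1, h3⟩ := hz _ hl₁
      obtain ⟨h1', h3'⟩ := hz _ hl₂
      have hlt : z l₁ < z l₂ :=
        lt_of_add_mul_tan_lt (k := π / 2) (by positivity) h1 h1' (by simpa [h3, h3'])
      have key : ∀ l, 0 < l → ((π / 2 + z l) / l) ^ 2 - (π / 2 / l) ^ 2
          = α ^ 2 * (π / 2 / (π / 2 + z l) ^ 2 + 1 / (π / 2 + z l))
            * (z l / tan (z l)) * (1 / tan (z l)) := by
        intro l hl
        obtain ⟨h1, h3⟩ := hz _ hl
        have ht := tan_pos_of_pos_of_lt_pi_div_two h1.1 h1.2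
        have h4 : 0 < π / 2 + z l := by linarith [h1.1]
        have : l = (π / 2 + z l) * tan (z l) / α := by rw [h3]; field_simp
        rw [show ∀ x, (x / l) ^ 2 = x ^ 2 / l ^ 2 from fun x => div_pow _ _ _,
          show ∀ x, (x / l) ^ 2 = x ^ 2 / l ^ 2 from fun x => div_pow _ _ _, ← sub_div]
        rw [show l ^ 2 = ((π / 2 + z l) * tan (z l) / α) ^ 2 by rw [← this]]
        field_simp
        ring
      rw [key _ hl₁, key _ hl₂]
      have q1 := h1.1
      have q2 := h1'.1
      have t1 := tan_pos_of_pos_of_lt_pi_div_two h1.1 h1.2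
      have t2 : tan (z l₁) < tan (z l₂) := tan_lt_tan_of_nonneg_of_lt_pi_div_two q1.le h1'.2 hlt
      have t3 : 0 < tan (z l₂) := t1.trans t2
      have t4 : z l₂ / tan (z l₂) ≤ z l₁ / tan (z l₁) := by
        have := monotoneOn_tan_div h1 h1' hlt.le
        simp only at this
        rw [div_le_div_iff₀ q1 q2] at this
        rw [div_le_div_iff₀ t3 t1]
        linarith
      have t5 : 1 / tan (z l₂) < 1 / tan (z l₁) := one_div_lt_one_div_of_lt t1 t2
      refine mul_lt_mul' (mul_le_mul (mul_le_mul_of_nonneg_left ?_ (by positivity)) t4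
        (by positivity) (by positivity)) t5 (by positivity) (by positivity)
      gcongr
    linarith
  · exact Or.inl fun l hl => by
      have := (hy l hl).1.1
      positivity
  · intro l hl
    obtain ⟨h1, h3⟩ := hy _ hl
    obtain ⟨K, hK⟩ := exists_inv_tan_sq_ge h1
    refine ⟨α ^ 2 * K, fun l' hl' => ?_⟩
    have := hK _ (hy _ hl').1
    rw [h3, (hy _ hl').2, log_mul hα.ne' hl.ne', log_mul hα.ne' hl'.ne'] at this
    rw [abs_of_nonneg (sq_nonneg _), abs_of_nonneg (sq_nonneg _), hμ l hl, hμ l' hl']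
    have h2 := mul_le_mul_of_nonneg_left this (sq_nonneg α)
    linarith

end Trig

section Hyperbolic

open Real

lemma tanh_lt_tanh_of_lt {x y : ℝ} (h : x < y) : tanh x < tanh y := by
  rw [tanh_eq_sinh_div_cosh, tanh_eq_sinh_div_cosh, div_lt_div_iff₀ (cosh_pos _) (cosh_pos _)]
  have : 0 < sinh (y - x) := sinh_pos_iff.2 (sub_pos.2 h)
  rw [sinh_sub] at this
  linarith

lemma tanh_pos_of_pos {x : ℝ} (h : 0 < x) : 0 < tanh x := by
  simpa using tanh_lt_tanh_of_lt h

lemma sinh_le_mul_cosh {y : ℝ} (hy : 0 ≤ y) : sinh y ≤ y * cosh y := by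
  have hder : ∀ y, HasDerivAt (fun y => y * cosh y - sinh y) (y * sinh y) y := fun y =>
    (((hasDerivAt_id y).mul (hasDerivAt_cosh y)).sub (hasDerivAt_sinh y)).congr_deriv (by simp)
  have hmono : MonotoneOn (fun y => y * cosh y - sinh y) (Set.Ici 0) := by
    refine monotoneOn_of_deriv_nonneg (convex_Ici 0)
      (fun y _ => (hder y).continuousAt.continuousWithinAt)
      (fun y _ => (hder y).differentiableAt.differentiableWithinAt) fun y hy => ?_
    rw [interior_Ici] at hy
    rw [(hder y).deriv]
    have : 0 < sinh y := sinh_pos_iff.2 hy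
    have : 0 < y := hy
    positivity
  have := hmono (Set.mem_Ici.2 le_rfl) (Set.mem_Ici.2 hy) hy
  simpa using this

lemma sinh_lt_mul_cosh {y : ℝ} (hy : 0 < y) : sinh y < y * cosh y := by
  have h1 := sinh_le_mul_cosh (y := y / 2) (by linarith)
  have e1 : sinh y = 2 * sinh (y / 2) * cosh (y / 2) := by rw [← sinh_two_mul]; ring_nf
  have e2 : cosh y = cosh (y / 2) ^ 2 + sinh (y / 2) ^ 2 := by rw [← cosh_two_mul]; ring_nf
  have h2 := cosh_pos (y / 2)
  have h3 : 0 < sinh (y / 2) := sinh_pos_iff.2 (by linarith)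
  have h4 : 0 < y * sinh (y / 2) ^ 2 := by positivity
  rw [e1, e2]
  nlinarith

lemma monotoneOn_sinh_div : MonotoneOn (fun y => sinh y / y) (Set.Ioi 0) := by
  have hder : ∀ y ∈ Set.Ioi (0 : ℝ), HasDerivAt (fun y => sinh y / y)
      ((cosh y * y - sinh y * 1) / y ^ 2) y := fun y hy =>
    (hasDerivAt_sinh y).div (hasDerivAt_id y) (ne_of_gt hy)
  refine monotoneOn_of_deriv_nonneg (convex_Ioi _)
    (fun y hy => (hder y hy).continuousAt.continuousWithinAt)
    (fun y hy => ((hder y (interior_subset hy)).differentiableAt).differentiableWithinAt) ?_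
  intro y hy
  rw [interior_Ioi] at hy
  rw [(hder y hy).deriv]
  have := sinh_le_mul_cosh (le_of_lt hy)
  exact div_nonneg (by linarith) (sq_nonneg y)

lemma hasDerivAt_tanh_real (y : ℝ) : HasDerivAt tanh (1 / cosh y ^ 2) y := by
  have : tanh = fun y => sinh y / cosh y := funext tanh_eq_sinh_div_cosh
  rw [this]
  refine ((hasDerivAt_sinh y).div (hasDerivAt_cosh y) (cosh_pos y).ne').congr_deriv ?_
  rw [← cosh_sq_sub_sinh_sq y]
  ring

/-- Tangent line inequality for `coth² y` as a function of `log (y tanh y)`. -/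
lemma exists_inv_tanh_sq_ge {x : ℝ} (hx : 0 < x) : ∃ K, ∀ y, 0 < y →
    (tanh x ^ 2)⁻¹ - K * (log (y * tanh y) - log (x * tanh x)) ≤ (tanh y ^ 2)⁻¹ := by
  refine ⟨_, fun y hy => le_of_hasDerivAt_ratio (I := Set.Ioi 0)
    (f := fun y => (tanh y ^ 2)⁻¹) (g := fun y => log (y * tanh y))
    (E := fun y => 2 / (tanh y ^ 2 + (sinh y / y) * (sinh y * tanh y)))
    (g' := fun y => 1 / y + 1 / (sinh y * cosh y))
    Set.ordConnected_Ioi (fun y hy => ?_) (fun y hy => ?_) (fun y hy => ?_) ?_ hx hy⟩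
  · have hc := cosh_pos y
    have hs : 0 < sinh y := sinh_pos_iff.2 hy
    have hy0 : 0 < y := hy
    have ht := tanh_pos_of_pos hy0
    refine (((hasDerivAt_tanh_real y).pow 2).inv (by simp; positivity)).congr_deriv ?_
    simp only [Pi.pow_apply, tanh_eq_sinh_div_cosh, Nat.cast_ofNat, Nat.add_one_sub_one, pow_one]
    field_simp
    ring
  · have hc := cosh_pos y
    have hs : 0 < sinh y := sinh_pos_iff.2 hy
    have hy0 : 0 < y := hy
    have ht := tanh_pos_of_pos hy0
    refine (((hasDerivAt_id y).mul (hasDerivAt_tanh_real y)).log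
      (mul_pos hy0 ht).ne').congr_deriv ?_
    simp only [Pi.mul_apply, id, tanh_eq_sinh_div_cosh]
    field_simp
  · have hc := cosh_pos y
    have hs : 0 < sinh y := sinh_pos_iff.2 hy
    have hy0 : 0 < y := hy
    positivity
  · intro p hp q hq hpq
    have hp0 : 0 < p := hp
    have hs : 0 < sinh p := sinh_pos_iff.2 hp
    have ht := tanh_pos_of_pos hp0
    have hq0 : 0 < q := hq
    have hsq : 0 < sinh q := sinh_pos_iff.2 hq0
    have h1 := monotoneOn_sinh_div hp hq hpq
    have h2 : tanh p ≤ tanh q := hpq.eq_or_lt.elim (fun h => h ▸ le_rfl)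
      fun h => (tanh_lt_tanh_of_lt h).le
    have h3 : sinh p ≤ sinh q := sinh_le_sinh.2 hpq
    simp only at h1 ⊢
    gcongr

lemma exists_mul_tanh_eq {s : ℝ} (hs : 0 < s) : ∃ y, 0 < y ∧ y * tanh y = s := by
  have hcont : ContinuousOn (fun y => y * sinh y - s * cosh y) (Set.Icc 0 (s + 1)) := by fun_prop
  have hmem : (0 : ℝ) ∈ Set.Ioo (0 * sinh 0 - s * cosh 0)
      ((s + 1) * sinh (s + 1) - s * cosh (s + 1)) := by
    refine ⟨by simpa using hs, ?_⟩
    rw [sinh_eq, cosh_eq]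
    have h1 : 2 * (s + 1) + 1 ≤ exp (2 * (s + 1)) := add_one_le_exp _
    have h2 : exp (s + 1) = exp (2 * (s + 1)) * exp (-(s + 1)) := by rw [← exp_add]; ring_nf
    have h3 := exp_pos (-(s + 1))
    rw [h2]
    nlinarith
  obtain ⟨y, hy, h⟩ := intermediate_value_Ioo (by positivity) hcont hmem
  refine ⟨y, hy.1, ?_⟩
  have hc := cosh_pos y
  rw [tanh_eq_sinh_div_cosh]
  field_simp
  simp only at h
  linarith

lemma antitoneOn_tanh_div : AntitoneOn (fun y => tanh y / y) (Set.Ioi 0) := by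
  have hder : ∀ y ∈ Set.Ioi (0 : ℝ), HasDerivAt (fun y => tanh y / y)
      ((1 / cosh y ^ 2 * y - tanh y * 1) / y ^ 2) y := fun y hy =>
    (hasDerivAt_tanh_real y).div (hasDerivAt_id y) (ne_of_gt hy)
  refine antitoneOn_of_deriv_nonpos (convex_Ioi _)
    (fun y hy => (hder y hy).continuousAt.continuousWithinAt)
    (fun y hy => ((hder y (interior_subset hy)).differentiableAt).differentiableWithinAt) ?_
  intro y hy
  rw [interior_Ioi] at hy
  have hy0 : 0 < y := hy
  rw [(hder y hy).deriv]
  have h1 := self_lt_sinh_iff.2 hy0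
  have h2 := one_le_cosh y
  have h3 := cosh_pos y
  have : 1 / cosh y ^ 2 * y - tanh y * 1 ≤ 0 := by
    rw [tanh_eq_sinh_div_cosh, show 1 / cosh y ^ 2 * y - sinh y / cosh y * 1
      = (y - sinh y * cosh y) / cosh y ^ 2 by field_simp]
    exact div_nonpos_of_nonpos_of_nonneg (by nlinarith) (by positivity)
  exact div_nonpos_of_nonpos_of_nonneg this (sq_nonneg y)

/-- For an attractive Robin parameter `α < 0`, the second mode of an interval is trigonometric,
linear or hyperbolic, according to its length. If `s` is `-α` times the half-length, then the
second eigenvalue is `α²` times the number `t` described here. -/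
def SecondLevel (s t : ℝ) : Prop :=
  (∃ z ∈ Set.Ioo 0 (π / 2), z = s * tan z ∧ t = tan z ^ 2) ∨ (s = 1 ∧ t = 0) ∨
    ∃ z, 0 < z ∧ z = s * tanh z ∧ t = -tanh z ^ 2

lemma exists_secondLevel {s : ℝ} (hs : 0 < s) : ∃ t, SecondLevel s t := by
  rcases lt_trichotomy s 1 with h | h | h
  · have hcont : ContinuousOn (fun z => s * sin z - z * cos z) (Set.Icc (arccos s) (π / 2)) := by
      fun_prop
    have h0 : 0 < arccos s := arccos_pos.2 h
    have hmem : (0 : ℝ) ∈ Set.Ioo (s * sin (arccos s) - arccos s * cos (arccos s))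
        (s * sin (π / 2) - π / 2 * cos (π / 2)) := by
      rw [cos_arccos (by linarith) h.le, sin_pi_div_two, cos_pi_div_two]
      have := sin_lt h0
      constructor <;> nlinarith
    obtain ⟨z, hz, hz'⟩ := intermediate_value_Ioo (arccos_le_pi_div_two.2 hs.le) hcont hmem
    have hz0 := h0.trans hz.1
    have hc := cos_pos_of_mem_Ioo ⟨by linarith [pi_pos], hz.2⟩
    refine ⟨_, Or.inl ⟨z, ⟨hz0, hz.2⟩, ?_, rfl⟩⟩
    rw [tan_eq_sin_div_cos]
    field_simp
    simp only at hz'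
    linarith
  · exact ⟨0, Or.inr (Or.inl ⟨h, rfl⟩)⟩
  · have hcont : ContinuousOn (fun z => z * cosh z - s * sinh z) (Set.Icc (arcosh s) s) := by
      fun_prop
    have h0 : 0 < arcosh s := arcosh_pos h
    have hc : cosh (arcosh s) = s := cosh_arcosh h.le
    have h1 := self_lt_sinh_iff.2 h0
    have hle : arcosh s ≤ s := by
      have := sinh_lt_cosh (arcosh s)
      linarith
    have hmem : (0 : ℝ) ∈ Set.Ioo (arcosh s * cosh (arcosh s) - s * sinh (arcosh s))
        (s * cosh s - s * sinh s) := by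
      rw [hc]
      have := sinh_lt_cosh s
      constructor <;> nlinarith
    obtain ⟨z, hz, hz'⟩ := intermediate_value_Ioo hle hcont hmem
    have hc := cosh_pos z
    refine ⟨_, Or.inr (Or.inr ⟨z, h0.trans hz.1, ?_, rfl⟩)⟩
    rw [tanh_eq_sinh_div_cosh]
    field_simp
    simp only at hz'
    linarith

lemma tanh_lt_self {z : ℝ} (hz : 0 < z) : tanh z < z := by
  rw [tanh_eq_sinh_div_cosh, div_lt_iff₀ (cosh_pos z)]
  exact sinh_lt_mul_cosh hz

lemma SecondLevel.neg_one_lt {s t : ℝ} (h : SecondLevel s t) : -1 < t := by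
  rcases h with ⟨z, -, -, rfl⟩ | ⟨-, rfl⟩ | ⟨z, hz, -, rfl⟩
  · have := sq_nonneg (tan z)
    linarith
  · norm_num
  · have h1 := tanh_lt_one z
    have h2 := tanh_pos_of_pos hz
    nlinarith

lemma SecondLevel.lt_of_lt {s₁ s₂ t₁ t₂ : ℝ} (h₁ : SecondLevel s₁ t₁) (h₂ : SecondLevel s₂ t₂)
    (h : s₁ < s₂) : t₂ < t₁ := by
  have trig : ∀ {s z : ℝ}, z ∈ Set.Ioo 0 (π / 2) → z = s * tan z → s < 1 := by
    intro s z hz e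
    have := lt_tan hz.1 hz.2
    have := hz.1
    by_contra! hs
    nlinarith
  have hyp : ∀ {s z : ℝ}, 0 < z → z = s * tanh z → 1 < s := by
    intro s z hz e
    have := tanh_lt_self hz
    have := tanh_pos_of_pos hz
    by_contra! hs
    nlinarith
  rcases h₁ with ⟨z₁, hz₁, e₁, rfl⟩ | ⟨e₁, rfl⟩ | ⟨z₁, hz₁, e₁, rfl⟩ <;>
  rcases h₂ with ⟨z₂, hz₂, e₂, rfl⟩ | ⟨e₂, rfl⟩ | ⟨z₂, hz₂, e₂, rfl⟩
  · have t1 := tan_pos_of_pos_of_lt_pi_div_two hz₁.1 hz₁.2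
    have t2 := tan_pos_of_pos_of_lt_pi_div_two hz₂.1 hz₂.2
    have hlt : z₂ < z₁ := by
      by_contra! hle
      have := monotoneOn_tan_div hz₁ hz₂ hle
      simp only at this
      rw [div_le_div_iff₀ hz₁.1 hz₂.1] at this
      nlinarith [mul_pos t1 t2]
    have := tan_lt_tan_of_nonneg_of_lt_pi_div_two hz₂.1.le hz₁.2 hlt
    gcongr
  · have := tan_pos_of_pos_of_lt_pi_div_two hz₁.1 hz₁.2
    positivity
  · have := tan_pos_of_pos_of_lt_pi_div_two hz₁.1 hz₁.2
    have := tanh_pos_of_pos hz₂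
    have h3 : 0 < tan z₁ ^ 2 := by positivity
    have h4 : 0 < tanh z₂ ^ 2 := by positivity
    linarith
  · linarith [trig hz₂ e₂]
  · linarith
  · have := tanh_pos_of_pos hz₂
    have h4 : 0 < tanh z₂ ^ 2 := by positivity
    linarith
  · linarith [trig hz₂ e₂, hyp hz₁ e₁]
  · linarith [hyp hz₁ e₁]
  · have t1 := tanh_pos_of_pos hz₁
    have t2 := tanh_pos_of_pos hz₂
    have hlt : z₁ < z₂ := by
      by_contra! hle
      have := antitoneOn_tanh_div (Set.mem_Ioi.2 hz₂) (Set.mem_Ioi.2 hz₁) hle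
      simp only at this
      rw [div_le_div_iff₀ hz₁ hz₂] at this
      nlinarith [mul_pos t1 t2]
    have := tanh_lt_tanh_of_lt hlt
    have : tanh z₁ ^ 2 < tanh z₂ ^ 2 := by gcongr
    linarith

lemma SecondLevel.exists_isOddMode {c a b t : ℝ} (hc : 0 < c)
    (h : SecondLevel (c * ((b - a) / 2)) t) : ∃ w, IsOddMode (-c) a b (c ^ 2 * t) w := by
  rcases h with ⟨z, hz, e, rfl⟩ | ⟨e, rfl⟩ | ⟨z, hz, e, rfl⟩
  · have ht := tan_pos_of_pos_of_lt_pi_div_two hz.1 hz.2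
    have hcos := cos_pos_of_mem_Ioo ⟨by linarith [pi_pos, hz.1], hz.2⟩
    have ez : c * tan z * ((b - a) / 2) = z := by linarith
    refine ⟨_, mul_pow c (tan z) 2 ▸ isOddMode_sin (r := c * tan z) (by positivity) ?_ ?_⟩
    · rw [ez]; linarith [hz.2, pi_pos]
    · rw [ez, mul_assoc, tan_mul_cos hcos.ne']; ring
  · exact ⟨_, (mul_zero (c ^ 2)).symm ▸ isOddMode_linear (by linarith)⟩
  · have ht := tanh_pos_of_pos hz
    have hcosh := cosh_pos z
    have ez : c * tanh z * ((b - a) / 2) = z := by linarith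
    have er : c ^ 2 * -tanh z ^ 2 = -(c * tanh z) ^ 2 := by ring
    refine ⟨_, er ▸ isOddMode_sinh (r := c * tanh z) (by positivity) ?_⟩
    rw [ez, tanh_eq_sinh_div_cosh]
    field_simp

theorem exists_robinSpectrum_of_neg {α : ℝ} (hα : α < 0) : ∃ μ ν, RobinSpectrum α μ ν := by
  obtain ⟨c, hc, rfl⟩ : ∃ c : ℝ, 0 < c ∧ α = -c := ⟨-α, by linarith, by ring⟩
  have hy : ∀ l : ℝ, ∃ y, 0 < l → 0 < y ∧ y * tanh y = c * l := by
    intro l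
    by_cases hl : 0 < l
    · obtain ⟨y, h⟩ := exists_mul_tanh_eq (mul_pos hc hl)
      exact ⟨y, fun _ => h⟩
    · exact ⟨0, fun h => absurd h hl⟩
  have ht : ∀ l : ℝ, ∃ t, 0 < l → SecondLevel (c * l) t := by
    intro l
    by_cases hl : 0 < l
    · obtain ⟨t, h⟩ := exists_secondLevel (mul_pos hc hl)
      exact ⟨t, fun _ => h⟩
    · exact ⟨0, fun h => absurd h hl⟩
  choose y hy using hy
  choose t ht using ht
  have hc2 : 0 < c ^ 2 := by positivity
  have htanh : ∀ l, 0 < l → 0 < tanh (y l) := fun l hl => tanh_pos_of_pos (hy l hl).1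
  have hinv : ∀ l, 0 < l → 1 < (tanh (y l) ^ 2)⁻¹ := by
    intro l hl
    have h1 := htanh l hl
    have h2 := tanh_lt_one (y l)
    exact (one_lt_inv₀ (by positivity)).2 (by nlinarith)
  have hμ : ∀ l, 0 < l → (y l / l) ^ 2 = c ^ 2 * (tanh (y l) ^ 2)⁻¹ := by
    intro l hl
    have h1 := htanh l hl
    rw [show y l / l = c / tanh (y l) by rw [div_eq_div_iff hl.ne' h1.ne', (hy l hl).2]]
    field_simp
  refine ⟨fun l => -(y l / l) ^ 2, fun l => c ^ 2 * t l, ?_, ?_, ?_, ?_⟩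
  · intro a b hab
    have hl : 0 < (b - a) / 2 := by linarith
    obtain ⟨w, hw⟩ := (ht _ hl).exists_isOddMode hc
    obtain ⟨h1, h3⟩ := hy _ hl
    set l := (b - a) / 2 with hldef
    have hcosh := cosh_pos (y l)
    rw [tanh_eq_sinh_div_cosh] at h3
    have e1 : y l / l * ((b - a) / 2) = y l := by rw [← hldef]; field_simp
    refine ⟨_, w, hw.robinPair hab (robinMode_cosh (r := y l / l) ?_) (by simp) ?_⟩
    · rw [e1]
      field_simp at h3 ⊢
      linarith
    · have h4 := (ht l hl).neg_one_lt
      have h5 := hinv l hl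
      simp only [hμ l hl]
      nlinarith
  · intro l₁ l₂ hl₁ hlt
    have hl₂ := hl₁.trans hlt
    have hlt' : c * l₁ < c * l₂ := mul_lt_mul_of_pos_left hlt hc
    have first := (ht l₁ hl₁).lt_of_lt (ht l₂ hl₂) hlt'
    have hy12 : y l₁ < y l₂ := by
      by_contra! hle
      have h1 : tanh (y l₂) ≤ tanh (y l₁) := hle.eq_or_lt.elim (fun h => h ▸ le_rfl)
        fun h => (tanh_lt_tanh_of_lt h).le
      have h2 := htanh l₂ hl₂
      have h3 := (hy l₁ hl₁).1
      have : y l₂ * tanh (y l₂) ≤ y l₁ * tanh (y l₁) := by gcongr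
      rw [(hy l₁ hl₁).2, (hy l₂ hl₂).2] at this
      linarith
    have h1 := htanh l₁ hl₁
    have h2 := tanh_lt_tanh_of_lt hy12
    have : (tanh (y l₂) ^ 2)⁻¹ < (tanh (y l₁) ^ 2)⁻¹ := by gcongr
    simp only [hμ _ hl₁, hμ _ hl₂]
    nlinarith
  · exact Or.inr fun l hl => by
      have := (hy l hl).1
      exact neg_lt_zero.2 (by positivity)
  · intro l hl
    obtain ⟨h1, h3⟩ := hy _ hl
    obtain ⟨K, hK⟩ := exists_inv_tanh_sq_ge h1
    refine ⟨c ^ 2 * K, fun l' hl' => ?_⟩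
    have := hK _ (hy _ hl').1
    rw [h3, (hy _ hl').2, log_mul hc.ne' hl.ne', log_mul hc.ne' hl'.ne'] at this
    rw [abs_neg, abs_neg, abs_of_nonneg (sq_nonneg _), abs_of_nonneg (sq_nonneg _), hμ l hl,
      hμ l' hl']
    have h2 := mul_le_mul_of_nonneg_left this (sq_nonneg c)
    linarith

end Hyperbolic

section Ratio

variable {n : ℕ} {a b : Fin n → ℝ} {α : ℝ} {μ ν : ℝ → ℝ}

lemma RobinSpectrum.gap_pos (h : RobinSpectrum α μ ν) {l : ℝ} (hl : 0 < l) : 0 < ν l - μ l := by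
  obtain ⟨u, w, hp⟩ := h.pair 0 (2 * l) (by linarith)
  have := hp.lt
  rw [show (2 * l - 0) / 2 = l by ring] at this
  exact sub_pos.2 this

/-- The first two eigenvalues of a box, in terms of those of its edges. -/
lemma RobinSpectrum.robinEigenvalue_eq (h : RobinSpectrum α μ ν) (hab : ∀ i, a i < b i)
    {j : Fin n} (hj : ∀ i, b i - a i ≤ b j - a j) :
    robinEigenvalue a b α 1 = ∑ i, μ ((b i - a i) / 2) ∧
    robinEigenvalue a b α 2 = (∑ i, μ ((b i - a i) / 2))
      + (ν ((b j - a j) / 2) - μ ((b j - a j) / 2)) := by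
  choose u w hp using fun i => h.pair (a i) (b i) (hab i)
  have hpos : ∀ i, 0 < (b i - a i) / 2 := fun i => half_pos (sub_pos.2 (hab i))
  have hγ : ∀ i, ν ((b j - a j) / 2) - μ ((b j - a j) / 2)
      ≤ ν ((b i - a i) / 2) - μ ((b i - a i) / 2) := by
    intro i
    rcases (hj i).eq_or_lt with e | e
    · rw [e]
    · exact (h.gap_anti _ _ (hpos i) (by linarith)).le
  exact ⟨robinEigenvalue_one hp hγ (h.gap_pos (hpos j)),
    robinEigenvalue_two hp hγ (h.gap_pos (hpos j)) rfl⟩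

/-- The sign of the first eigenvalue determines the ratio up to the quotient of the smallest gap
by the sum of the one-dimensional ground state energies. -/
lemma RobinSpectrum.exists_spectralRatio_eq (h : RobinSpectrum α μ ν) : ∃ s : ℝ,
    ∀ {n : ℕ} {a b : Fin n → ℝ}, (∀ i, a i < b i) → ∀ {j : Fin n},
      (∀ i, b i - a i ≤ b j - a j) → robinEigenvalue a b α 1 ≠ 0 ∧
      spectralRatio a b α = s + (ν ((b j - a j) / 2) - μ ((b j - a j) / 2))
        / ∑ i, |μ ((b i - a i) / 2)| := by
  rcases h.sign with hs | hs
  · refine ⟨1, fun {n a b} hab {j} hj => ?_⟩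
    obtain ⟨e1, e2⟩ := h.robinEigenvalue_eq hab hj
    have hpos : ∀ i, 0 < μ ((b i - a i) / 2) := fun i => hs _ (half_pos (sub_pos.2 (hab i)))
    have hsum : 0 < ∑ i, μ ((b i - a i) / 2) := Finset.sum_pos (fun i _ => hpos i) ⟨j, by simp⟩
    refine ⟨by rw [e1]; exact hsum.ne', ?_⟩
    rw [spectralRatio, e1, e2, abs_of_pos hsum, Finset.sum_congr rfl fun i _ => abs_of_pos (hpos i)]
    field_simp
  · refine ⟨-1, fun {n a b} hab {j} hj => ?_⟩
    obtain ⟨e1, e2⟩ := h.robinEigenvalue_eq hab hj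
    have hneg : ∀ i, μ ((b i - a i) / 2) < 0 := fun i => hs _ (half_pos (sub_pos.2 (hab i)))
    have hsum : ∑ i, μ ((b i - a i) / 2) < 0 := Finset.sum_neg (fun i _ => hneg i) ⟨j, by simp⟩
    refine ⟨by rw [e1]; exact hsum.ne, ?_⟩
    rw [spectralRatio, e1, e2, abs_of_neg hsum, Finset.sum_congr rfl fun i _ => abs_of_neg (hneg i),
      Finset.sum_neg_distrib]
    have := hsum.ne
    field_simp
    ring

lemma RobinSpectrum.card_mul_le_sum (h : RobinSpectrum α μ ν) {l : Fin n → ℝ} (hl : ∀ i, 0 < l i)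
    {l₀ : ℝ} (hl₀ : 0 < l₀) (hprod : ∏ i, l i = l₀ ^ n) : n * |μ l₀| ≤ ∑ i, |μ (l i)| := by
  obtain ⟨K, hK⟩ := h.log_convex l₀ hl₀
  have hlog : ∑ i, (Real.log (l i) - Real.log l₀) = 0 := by
    rw [Finset.sum_sub_distrib, ← Real.log_prod fun i _ => (hl i).ne', hprod, Real.log_pow]
    simp
  calc (n : ℝ) * |μ l₀| = ∑ i, (|μ l₀| - K * (Real.log (l i) - Real.log l₀)) := by
        rw [Finset.sum_sub_distrib, ← Finset.mul_sum, hlog]; simp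
    _ ≤ _ := Finset.sum_le_sum fun i _ => hK _ (hl i)

lemma volume_openBox_eq_iff {c d : Fin n → ℝ} (hab : ∀ i, a i < b i) (hcd : ∀ i, c i < d i) :
    volume (openBox a b) = volume (openBox c d) ↔ ∏ i, (b i - a i) = ∏ i, (d i - c i) := by
  have key : ∀ {a b : Fin n → ℝ}, (∀ i, a i < b i) →
      volume (openBox a b) = ENNReal.ofReal (∏ i, (b i - a i)) := by
    intro a b hab
    rw [openBox, Real.volume_pi_Ioo, ENNReal.ofReal_prod_of_nonneg]
    exact fun i _ => (sub_pos.2 (hab i)).le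
  rw [key hab, key hcd, ENNReal.ofReal_eq_ofReal_iff]
  · exact Finset.prod_nonneg fun i _ => (sub_pos.2 (hab i)).le
  · exact Finset.prod_nonneg fun i _ => (sub_pos.2 (hcd i)).le

theorem RobinSpectrum.ratio_theorem (h : RobinSpectrum α μ ν) (hn : 0 < n) :
    (∀ a b : Fin n → ℝ, (∀ i, a i < b i) → robinEigenvalue a b α 1 ≠ 0) ∧
    ∀ a b c d : Fin n → ℝ, (∀ i, a i < b i) → (∀ i, c i < d i) → IsCube c d →
      volume (openBox a b) = volume (openBox c d) →
        spectralRatio a b α ≤ spectralRatio c d α ∧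
        (spectralRatio a b α = spectralRatio c d α ↔ IsCube a b) := by
  have : Nonempty (Fin n) := ⟨⟨0, hn⟩⟩
  obtain ⟨s, hs⟩ := h.exists_spectralRatio_eq
  have hmax : ∀ a b : Fin n → ℝ, ∃ j, ∀ i, b i - a i ≤ b j - a j := fun a b =>
    Finite.exists_max fun i => b i - a i
  refine ⟨fun a b hab => ?_, fun a b c d hab hcd hcube hvol => ?_⟩
  · obtain ⟨j, hj⟩ := hmax a b
    exact (hs hab hj).1
  obtain ⟨j, hj⟩ := hmax a b
  set L := d j - c j with hL
  have hside : ∀ i, d i - c i = L := fun i => hcube i j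
  have hLpos : 0 < L := sub_pos.2 (hcd j)
  have hpos : ∀ i, 0 < b i - a i := fun i => sub_pos.2 (hab i)
  rw [volume_openBox_eq_iff hab hcd] at hvol
  simp only [hside, Finset.prod_const, Finset.card_univ, Fintype.card_fin] at hvol
  have hB := (hs hab hj).2
  have hQ := (hs hcd (j := j) fun i => (hside i).le).2
  simp only [hside, Finset.sum_const, Finset.card_univ, Fintype.card_fin, nsmul_eq_mul] at hQ
  have hiff : IsCube a b ↔ ∀ i, b i - a i = L := by
    refine ⟨fun hc i => ?_, fun hc i k => by rw [hc, hc]⟩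
    have : ∀ k, b k - a k = b i - a i := fun k => hc k i
    simp only [this, Finset.prod_const, Finset.card_univ, Fintype.card_fin] at hvol
    exact (pow_left_inj₀ (hpos i).le hLpos.le hn.ne').1 hvol
  by_cases hc : ∀ i, b i - a i = L
  · have : spectralRatio a b α = spectralRatio c d α := by
      rw [hB, hQ]
      simp only [hc, Finset.sum_const, Finset.card_univ, Fintype.card_fin, nsmul_eq_mul]
    exact ⟨this.le, fun _ => hiff.2 hc, fun _ => this⟩
  · have hlt : L < b j - a j := by
      by_contra! hle
      push Not at hc
      obtain ⟨k, hk⟩ := hc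
      have hk' : b k - a k < L := lt_of_le_of_ne ((hj k).trans hle) hk
      have := Finset.prod_lt_prod (s := Finset.univ) (f := fun i => b i - a i) (g := fun _ => L)
        (fun i _ => hpos i) (fun i _ => (hj i).trans hle) ⟨k, Finset.mem_univ k, hk'⟩
      simp only [Finset.prod_const, Finset.card_univ, Fintype.card_fin] at this
      exact this.ne hvol
    have hμ : μ (L / 2) ≠ 0 := by
      rcases h.sign with h' | h'
      · exact (h' _ (half_pos hLpos)).ne'
      · exact (h' _ (half_pos hLpos)).ne
    have hsum : n * |μ (L / 2)| ≤ ∑ i, |μ ((b i - a i) / 2)| := by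
      refine h.card_mul_le_sum (fun i => half_pos (hpos i)) (half_pos hLpos) ?_
      rw [Finset.prod_div_distrib, hvol]
      simp [div_pow]
    have hn' : (0 : ℝ) < n := Nat.cast_pos.2 hn
    have hpos' : 0 < n * |μ (L / 2)| := mul_pos hn' (abs_pos.2 hμ)
    have hstrict : spectralRatio a b α < spectralRatio c d α := by
      rw [hB, hQ]
      have h1 := h.gap_anti (L / 2) ((b j - a j) / 2) (half_pos hLpos) (by linarith)
      have h2 := h.gap_pos (half_pos (hpos j))
      have : (ν ((b j - a j) / 2) - μ ((b j - a j) / 2)) / ∑ i, |μ ((b i - a i) / 2)|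
          < (ν (L / 2) - μ (L / 2)) / (n * |μ (L / 2)|) :=
        div_lt_div₀ h1 hsum (h2.trans h1).le hpos'
      linarith
    exact ⟨hstrict.le, fun e => absurd e hstrict.ne, fun e => absurd (hiff.1 e) hc⟩

end Ratio

theorem mainTheorem9 (n : ℕ) (hn : 2 ≤ n) (α : ℝ) (hα : α ≠ 0) :
    (∀ a b : Fin n → ℝ, (∀ i, a i < b i) → robinEigenvalue a b α 1 ≠ 0) ∧
    ∀ a b c d : Fin n → ℝ, (∀ i, a i < b i) → (∀ i, c i < d i) → IsCube c d →
      volume (openBox a b) = volume (openBox c d) →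
        spectralRatio a b α ≤ spectralRatio c d α ∧
        (spectralRatio a b α = spectralRatio c d α ↔ IsCube a b) := by
  obtain ⟨μ, ν, h⟩ : ∃ μ ν, RobinSpectrum α μ ν := by
    rcases hα.lt_or_gt with h | h
    · exact exists_robinSpectrum_of_neg h
    · exact exists_robinSpectrum_of_pos h
  exact h.ratio_theorem (by omega)
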